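/- Let $n\in\mathbb{N}$ with $n\ge 1$, let $d\in\mathbb{N}_0$, and let $s=(s_\alpha)_{\alpha\in\mathbb{N}_0^n}$ be a real sequence. Notation. A (non-negative Borel) measure $\mu$ on $\mathbb{R}^n$ represents $s$ if, for all $\alpha\in\mathbb{N}_0^n$, $x^\alpha$ is $\mu$-integrable and $s_\alpha=\int_{\mathbb{R}^n}x^\alpha\,\mathrm{d}\mu(x)$; $s$ is a determinate moment sequence if it has exactly one such representing measure. Let $L_s:\mathbb{R}[x_1,\dots,x_n]\to\mathbb{R}$ be the linear functional with $L_s(x^\alpha)=s_\alpha$. For $\beta\in\mathbb{N}_0^n$ the sequence $\partial^\beta s$ is given by $\partial^\beta s_\alpha:=(-1)^{|\beta|}L_s(\partial^\beta x^\alpha)$. Set $$f(z):=\sum_{\alpha\in\mathbb{N}_0^n}\frac{i^{|\alpha|}\,s_\alpha}{\alpha!}\,z^\alpha,\qquad f_\beta(z):=\sum_{\alpha\in\mathbb{N}_0^n}\frac{i^{|\alpha|}\,(\partial^\beta s_\alpha)}{\alpha!}\,z^\alpha .$$ Such a series is called entire if it converges (absolutely) for every $z\in\mathbb{C}^n$;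 membership in $L^2(\mathbb{R}^n,\mathbb{C})$ refers to its restriction to $\mathbb{R}^n$. For $h\in L^2(\mathbb{R}^n,\mathbb{C})$ let $\check h\in L^2(\mathbb{R}^n,\mathbb{C})$ be its unitary inverse Fourier transform, normalized as the inverse of the characteristic-function transform, i.e. the continuous extension to $L^2$ of $h\mapsto (2\pi)^{-n/2}\int_{\mathbb{R}^n}e^{-i\langle x,z\rangle}h(z)\,\mathrm{d}z$. Supports of $L^2$-functions are essential supports, and $\partial^\beta g\in L^2$ is meant for the distributional derivative. Then the following are equivalent: (i) $f$ is entire, and (a) $x^\beta f\in L^2(\mathbb{R}^n,\mathbb{C})$ for all $\beta\in\mathbb{N}_0^n$ with $|\beta|\le d$, (b) $g:=(2\pi)^{-n/2}\check f\ge 0$ almost everywhere on $\mathbb{R}^n$, (c) there is a constant $c\ge 0$ with $\operatorname{supp} g\subseteq[-c,c]^n$. (ii) $f$ is entire, and (a) $x^\beta f\in L^2(\mathbb{R}^n,\mathbb{C})$ for all $\beta\in\mathbb{N}_0^n$ with $|\beta|\le d$, (b) $g:=(2\pi)^{-n/2}\check f\ge 0$ almost everywhere on $\mathbb{R}^n$,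 (c) there is a constant $c\ge 0$ such that, for all $j=1,\dots,n$, the limit $\lim_{k\to\infty}\sqrt[2k]{s_{2k\cdot e_j}}$ exists and is at most $c$. (iii) For all $\beta\in\mathbb{N}_0^n$ with $|\beta|\le d$ the function $f_\beta$ is entire, and (a) $f_\beta\in L^2(\mathbb{R}^n,\mathbb{C})$ for all $\beta\in\mathbb{N}_0^n$ with $|\beta|\le d$, (b) $g:=(2\pi)^{-n/2}\check f_0\ge 0$ almost everywhere on $\mathbb{R}^n$, (c) there is a constant $c\ge 0$ with $\operatorname{supp} g\subseteq[-c,c]^n$. (iv) For all $\beta\in\mathbb{N}_0^n$ with $|\beta|\le d$ the function $f_\beta$ is entire, and (a) $f_\beta\in L^2(\mathbb{R}^n,\mathbb{C})$ for all $\beta\in\mathbb{N}_0^n$ with $|\beta|\le d$, (b) $g:=(2\pi)^{-n/2}\check f_0\ge 0$ almost everywhere on $\mathbb{R}^n$, (c) there is a constant $c\ge 0$ such that, for all $j=1,\dots,n$, the limit $\lim_{k\to\infty}\sqrt[2k]{s_{2k\cdot e_j}}$ exists and is at most $c$. (v) $s$ is a determinate moment sequence with an absolutely continuous representing measure $\mu$,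 $\mathrm{d}\mu(x)=g(x)\,\mathrm{d}x$, with a density $g\in L^2(\mathbb{R}^n,\mathbb{C})$ such that (a) $\partial^\beta g\in L^2(\mathbb{R}^n,\mathbb{C})$ for all $\beta\in\mathbb{N}_0^n$ with $|\beta|\le d$, (b) $g\ge 0$ almost everywhere on $\mathbb{R}^n$, (c) $\operatorname{supp} g\subseteq[-c,c]^n$ for some constant $c\ge 0$. -/

import Mathlib

open MeasureTheory Filter Topology FourierTransform
open scoped ContDiff ENNReal

noncomputable section

namespace MomentDensity

variable {n : ℕ}

/-- The monomial function `x ↦ x ^ α` on `ℝⁿ`. -/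
def monom (α : Fin n →₀ ℕ) (x : EuclideanSpace ℝ (Fin n)) : ℝ := ∏ j, x j ^ α j

/-! ### Moment sequences -/

/-- The measure `μ` represents `s`: all moments of `μ` exist and are given by `s`. -/
def Represents (μ : Measure (EuclideanSpace ℝ (Fin n))) (s : (Fin n →₀ ℕ) → ℝ) : Prop :=
  ∀ α, Integrable (monom α) μ ∧ ∫ x, monom α x ∂μ = s α

/-- `s` is a determinate moment sequence: it has exactly one (non-negative) representing
measure. -/
def IsDeterminate (s : (Fin n →₀ ℕ) → ℝ) : Prop :=
  ∃! μ : Measure (EuclideanSpace ℝ (Fin n)), Represents μ s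

/-- The Riesz functional `L_s : ℝ[x₁, …, xₙ] → ℝ`, the linear map with `L_s (x ^ α) = s α`. -/
def riesz (s : (Fin n →₀ ℕ) → ℝ) : MvPolynomial (Fin n) ℝ →ₗ[ℝ] ℝ :=
  (MvPolynomial.basisMonomials (Fin n) ℝ).constr ℝ s

/-- The operator `∂ ^ β = ∂₁ ^ β₁ ⋯ ∂ₙ ^ βₙ` on polynomials. -/
def polyDeriv (β : Fin n →₀ ℕ) (p : MvPolynomial (Fin n) ℝ) : MvPolynomial (Fin n) ℝ :=
  (List.finRange n).foldr (fun j q => (fun r => MvPolynomial.pderiv j r)^[β j] q) p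

/-- The sequence `∂ ^ β s`, that is, `(∂ ^ β s) α = (-1) ^ |β| L_s (∂ ^ β x ^ α)`. -/
def momentDeriv (β : Fin n →₀ ℕ) (s : (Fin n →₀ ℕ) → ℝ) (α : Fin n →₀ ℕ) : ℝ :=
  (-1) ^ β.degree * riesz s (polyDeriv β (MvPolynomial.monomial α 1))

/-! ### The characteristic power series -/

/-- The term `i ^ |α| s_α / α! z ^ α`, for `z ∈ ℂⁿ`. -/
def charTerm (s : (Fin n →₀ ℕ) → ℝ) (z : Fin n → ℂ) (α : Fin n →₀ ℕ) : ℂ :=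
  Complex.I ^ α.degree * (s α : ℂ) / (∏ j, ((α j).factorial : ℂ)) * ∏ j, z j ^ α j

/-- The power series `∑_α i ^ |α| s_α / α! z ^ α` is entire: it converges (unconditionally,
hence absolutely) at every point of `ℂⁿ`. -/
def IsEntireSeries (s : (Fin n →₀ ℕ) → ℝ) : Prop :=
  ∀ z : Fin n → ℂ, Summable (charTerm s z)

/-- The function `f(z) = ∑_α i ^ |α| s_α / α! z ^ α`, restricted to `z ∈ ℝⁿ`. -/
def charSeries (s : (Fin n →₀ ℕ) → ℝ) (x : EuclideanSpace ℝ (Fin n)) : ℂ :=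
  ∑' α, charTerm s (fun j => (x j : ℂ)) α

/-! ### The inverse Fourier transform on `L²` -/

/-- The unitary inverse of the transform `g ↦ (2π)^(-n/2) ∫ exp(i⟨x, z⟩) g(x) dx` on
`L²(ℝⁿ, ℂ)`, that is, the continuous extension of
`f ↦ (x ↦ (2π)^(-n/2) ∫ exp(-i⟨x, z⟩) f(z) dz)` from the Schwartz functions. It is obtained from
the `L²`-transform `𝓕` of Mathlib, which has the kernel `exp(-2πi⟨x, z⟩)`, by rescaling. -/
def invFourier (f : Lp ℂ 2 (volume : Measure (EuclideanSpace ℝ (Fin n))))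
    (x : EuclideanSpace ℝ (Fin n)) : ℂ :=
  (((2 * Real.pi) ^ (-(n : ℝ) / 2) : ℝ) : ℂ) *
    (𝓕 f : Lp ℂ 2 (volume : Measure (EuclideanSpace ℝ (Fin n)))) ((2 * Real.pi)⁻¹ • x)

/-- The function `g = (2π)^(-n/2) · f̌`, for `f ∈ L²(ℝⁿ, ℂ)`. -/
def density (f : EuclideanSpace ℝ (Fin n) → ℂ) (hf : MemLp f 2 volume)
    (x : EuclideanSpace ℝ (Fin n)) : ℂ :=
  (((2 * Real.pi) ^ (-(n : ℝ) / 2) : ℝ) : ℂ) * invFourier (hf.toLp f) x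

/-! ### Conditions on the density -/

/-- `g ≥ 0` almost everywhere (in particular `g` is real almost everywhere). -/
def NonnegAE (g : EuclideanSpace ℝ (Fin n) → ℂ) : Prop :=
  ∀ᵐ x, 0 ≤ (g x).re ∧ (g x).im = 0

/-- `supp g ⊆ [-c, c]ⁿ` for the (essential) support: `g = 0` almost everywhere off the cube. -/
def SuppInCube (c : ℝ) (g : EuclideanSpace ℝ (Fin n) → ℂ) : Prop :=
  ∀ᵐ x, (¬ ∀ j, x j ∈ Set.Icc (-c) c) → g x = 0

/-- `lim_{k → ∞} (s_{2k·e_j})^{1/(2k)}` exists and is at most `c`, for every `j`. -/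
def MomentGrowth (c : ℝ) (s : (Fin n →₀ ℕ) → ℝ) : Prop :=
  ∀ j, ∃ l ≤ c,
    Tendsto (fun k : ℕ => s (Finsupp.single j (2 * k)) ^ (1 / (2 * (k : ℝ)))) atTop (𝓝 l)

/-- The classical partial derivative `∂ ^ β = ∂₁ ^ β₁ ⋯ ∂ₙ ^ βₙ` of a smooth function. -/
def partialDeriv (β : Fin n →₀ ℕ) (φ : EuclideanSpace ℝ (Fin n) → ℂ) :
    EuclideanSpace ℝ (Fin n) → ℂ :=
  (List.finRange n).foldr
    (fun j ψ => (fun η x => lineDeriv ℝ η x (EuclideanSpace.single j 1))^[β j] ψ) φ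

/-- The distributional (weak) derivative `∂ ^ β g` of `g` belongs to `L²(ℝⁿ, ℂ)`. -/
def WeakDerivMemL2 (β : Fin n →₀ ℕ) (g : EuclideanSpace ℝ (Fin n) → ℂ) : Prop :=
  ∃ h : EuclideanSpace ℝ (Fin n) → ℂ, MemLp h 2 volume ∧
    ∀ φ : EuclideanSpace ℝ (Fin n) → ℂ, ContDiff ℝ ∞ φ → HasCompactSupport φ →
      ∫ x, g x * partialDeriv β φ x = (-1) ^ β.degree * ∫ x, h x * φ x

end MomentDensity

end

/-! A measure on a cube has moments bounded by `C * c ^ |α|`. The exponential series may therefore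
be integrated term by term, and f is the characteristic function of the measure
(`Represents.hasSum_charTerm`). Thus f and g form a Fourier pair, and Plancherel exchanges `∂^β g ∈
L²` with `x^β f ∈ L²` (`weakDerivMemL2_density`, `memLp_monom_mul_of_weakDeriv`). Since `f_β =
(-i)^|β| x^β f` (`charSeries_momentDeriv`), statements (iii) and (iv) are rewritings of (i) and
(ii).

The substantial step starts from f alone. At first g is only an L² function, so finite mass and the
moments must be recovered. Pair g ≥ 0 with ever wider Gaussians: their transforms concentrate at 0,
where f is continuous, so the pairings stay bounded and Fatou makes g integrable
(`integrable_of_fourierL2_nonneg`). Inversion then holds pointwise, and f is the characteristic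
function of g dx. On each line through 0 this is a power series in one variable. Fatou applied to
second differences yields all even moments (`integrable_pow_of_contDiff_charFun`), and the Taylor
coefficients give their values. Comparing polynomials in the direction of the line separates the
multi-indices (`represents_of_charFun_eq`).

The 2k-th roots of the moments of `x_j` tend to the essential supremum of `|x_j|`, so moment growth
and support in a cube are the same condition (`Represents.momentGrowth_iff`). The growth condition
sees only s. Hence all representing measures live on the same cube and share one characteristic
function, which is determinacy. -/

noncomputable section

namespace MomentDensity

variable {n : ℕ}

/-! ### Duality and dilation for the Fourier transform on L². -/

section FourierL2

variable {V : Type*} [NormedAddCommGroup V] [InnerProductSpace ℝ V] [FiniteDimensional ℝ V]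
  [MeasurableSpace V] [BorelSpace V]

theorem continuous_fourier_of_integrable {u : V → ℂ} (hu : Integrable u) : Continuous (𝓕 u) :=
  VectorFourier.fourierIntegral_continuous Real.continuous_fourierChar
    (by exact continuous_inner) hu

theorem integral_fourier_mul_of_integrable {u v : V → ℂ} (hu : Integrable u) (hv : Integrable v) :
    ∫ x, 𝓕 u x * v x = ∫ x, u x * 𝓕 v x :=
  VectorFourier.integral_fourierIntegral_smul_eq_flip (μ := volume) (ν := volume) (L := innerₗ V)
    Real.continuous_fourierChar continuous_inner hu hv |>.trans (by
      simp only [flip_innerₗ]; rfl)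

theorem integral_fourierL2_mul_schwartz (U : Lp ℂ 2 (volume : Measure V)) (φ : SchwartzMap V ℂ) :
    ∫ x, (𝓕 U : Lp ℂ 2 (volume : Measure V)) x * φ x = ∫ x, U x * 𝓕 (φ : V → ℂ) x := by
  have h := congrArg (fun T => T φ) (Lp.fourier_toTemperedDistribution_eq U)
  simp only [TemperedDistribution.fourier_apply, Lp.toTemperedDistribution_apply, smul_eq_mul,
    SchwartzMap.fourier_coe] at h
  simp only [mul_comm _ (φ _), mul_comm (U _), h]

/-- Both sides are continuous in `W`, so it suffices to take `W` Schwartz, where this is the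
definition of the transform of a tempered distribution. -/
theorem integral_fourierL2_mul (U W : Lp ℂ 2 (volume : Measure V)) :
    ∫ x, (𝓕 U : Lp ℂ 2 (volume : Measure V)) x * W x =
      ∫ x, U x * (𝓕 W : Lp ℂ 2 (volume : Measure V)) x := by
  let B : Lp ℂ 2 (volume : Measure V) →L[ℂ] Lp ℂ 2 (volume : Measure V) →L[ℂ] ℂ :=
    (ContinuousLinearMap.mul ℂ ℂ).lpPairing volume 2 2
  have hB (f g : Lp ℂ 2 (volume : Measure V)) : B f g = ∫ x, f x * g x :=
    ContinuousLinearMap.lpPairing_eq_integral _ f g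
  rw [← hB, ← hB]
  refine DenseRange.induction_on (p := fun W => B (𝓕 U) W = B U (𝓕 W))
    (SchwartzMap.denseRange_toLpCLM (F := ℂ) (E := V) (p := 2) ENNReal.ofNat_ne_top) W ?_ ?_
  · exact isClosed_eq (B _).continuous
      ((B U).continuous.comp (Lp.fourierTransformₗᵢ V ℂ).continuous)
  · intro φ
    simp only [SchwartzMap.toLpCLM_apply]
    rw [SchwartzMap.toLp_fourier_eq, hB, hB]
    have h1 : ∫ x, (𝓕 U : Lp ℂ 2 (volume : Measure V)) x * (φ.toLp 2 : Lp ℂ 2 volume) x =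
        ∫ x, (𝓕 U : Lp ℂ 2 (volume : Measure V)) x * φ x := by
      refine integral_congr_ae ?_
      filter_upwards [φ.coeFn_toLp 2 volume] with x hx
      rw [hx]
    have h2 : ∫ x, U x * ((𝓕 φ).toLp 2 : Lp ℂ 2 volume) x = ∫ x, U x * 𝓕 (φ : V → ℂ) x := by
      refine integral_congr_ae ?_
      filter_upwards [(𝓕 φ).coeFn_toLp 2 volume] with x hx
      rw [hx, SchwartzMap.fourier_coe]
    rw [h1, h2, integral_fourierL2_mul_schwartz]

/-- Two locally integrable functions which agree as functionals on test functions agree. -/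
theorem ae_eq_of_integral_mul_schwartz_eq {f g : V → ℂ} (hf : LocallyIntegrable f)
    (hg : LocallyIntegrable g)
    (h : ∀ φ : SchwartzMap V ℂ, HasCompactSupport φ → ∫ x, f x * φ x = ∫ x, g x * φ x) :
    f =ᵐ[volume] g := by
  refine ae_eq_of_integral_contDiff_smul_eq hf hg fun χ hχ hc => ?_
  have hg₁ : HasCompactSupport (Complex.ofRealCLM ∘ χ) := hc.comp_left rfl
  have hg₂ : ContDiff ℝ ∞ (Complex.ofRealCLM ∘ χ) := by fun_prop
  have := h (hg₁.toSchwartzMap hg₂) hg₁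
  simpa [mul_comm] using this

/-- Against a test function, both transforms move over to it by self-duality and leave the same
integral. This links the L² extension to the integral formula. -/
theorem fourier_toLp_ae_eq {u : V → ℂ} (h1 : Integrable u) (h2 : MemLp u 2) :
    (𝓕 (h2.toLp u) : Lp ℂ 2 (volume : Measure V)) =ᵐ[volume] 𝓕 u := by
  refine ae_eq_of_integral_mul_schwartz_eq ((Lp.memLp _).locallyIntegrable one_le_two)
    (continuous_fourier_of_integrable h1).locallyIntegrable fun φ _ => ?_
  rw [integral_fourierL2_mul_schwartz, integral_fourier_mul_of_integrable h1 φ.integrable]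
  refine integral_congr_ae ?_
  filter_upwards [h2.coeFn_toLp] with x hx
  rw [hx]

theorem fourierInv_toLp_ae_eq {u : V → ℂ} (h1 : Integrable u) (h2 : MemLp u 2) :
    (𝓕⁻ (h2.toLp u) : Lp ℂ 2 (volume : Measure V)) =ᵐ[volume] 𝓕⁻ u := by
  have hinv : (𝓕⁻ u : V → ℂ) = 𝓕 (fun x => u (-x)) := by
    rw [Real.fourierInv_eq_fourier_comp_neg]
  refine ae_eq_of_integral_mul_schwartz_eq ((Lp.memLp _).locallyIntegrable one_le_two)
    (hinv ▸ (continuous_fourier_of_integrable h1.comp_neg)).locallyIntegrable fun φ _ => ?_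
  have h := congrArg (fun T => T φ) (Lp.fourierInv_toTemperedDistribution_eq (h2.toLp u))
  simp only [TemperedDistribution.fourierInv_apply, Lp.toTemperedDistribution_apply, smul_eq_mul,
    SchwartzMap.fourierInv_coe] at h
  simp only [mul_comm _ (φ _)]
  rw [← h, hinv]
  simp only [mul_comm (φ _)]
  rw [integral_fourier_mul_of_integrable h1.comp_neg φ.integrable, ← integral_neg_eq_self]
  refine integral_congr_ae ?_
  have hq : ∀ᵐ x : V, (h2.toLp u) (-x) = u (-x) :=
    (Measure.measurePreserving_neg (volume : Measure V)).quasiMeasurePreserving.ae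
      h2.coeFn_toLp
  filter_upwards [hq] with x hx
  rw [hx, Real.fourierInv_eq_fourier_neg, neg_neg, mul_comm]

theorem memLp_comp_smul {u : V → ℂ} {p : ℝ≥0∞} (hu : MemLp u p) {c : ℝ} (hc : c ≠ 0) :
    MemLp (fun x => u (c • x)) p := by
  have hm : AEMeasurable (fun x : V => c • x) volume := (measurable_const_smul c).aemeasurable
  refine MemLp.comp_of_map (g := u) ?_ hm
  rw [Measure.map_addHaar_smul _ hc]
  exact hu.smul_measure ENNReal.ofReal_ne_top

theorem fourier_comp_smul (φ : V → ℂ) {c : ℝ} (hc : 0 < c) (w : V) :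
    𝓕 (fun x => φ (c • x)) w = ((c ^ Module.finrank ℝ V)⁻¹ : ℝ) • 𝓕 φ (c⁻¹ • w) := by
  rw [Real.fourier_eq, Real.fourier_eq]
  have := Measure.integral_comp_smul (volume : Measure V)
    (fun v => Real.fourierChar (-(inner ℝ v (c⁻¹ • w))) • φ v) c
  rw [abs_of_pos (by positivity)] at this
  rw [← this]
  congr 1
  ext v
  congr 3
  rw [inner_smul_left, inner_smul_right]
  simp [hc.ne']

/-- Tested by duality: the dilation is moved onto the test function, where the scaling rule is a
change of variables in the integral formula. -/
theorem fourierL2_comp_smul {u : V → ℂ} (hu : MemLp u 2) {c : ℝ} (hc : 0 < c)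
    (huc : MemLp (fun x => u (c • x)) 2) :
    (fun x => ((c ^ Module.finrank ℝ V)⁻¹ : ℝ) •
      (𝓕 (hu.toLp u) : Lp ℂ 2 (volume : Measure V)) (c⁻¹ • x)) =ᵐ[volume]
    (𝓕 (huc.toLp _) : Lp ℂ 2 (volume : Measure V)) := by
  have hm := memLp_comp_smul (Lp.memLp (𝓕 (hu.toLp u))) (inv_ne_zero hc.ne')
  refine ae_eq_of_integral_mul_schwartz_eq
    ((hm.const_smul (c ^ Module.finrank ℝ V)⁻¹).locallyIntegrable one_le_two)
    ((Lp.memLp _).locallyIntegrable one_le_two) fun φ hφ => ?_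
  have hcs : HasCompactSupport (fun x => φ (c • x)) :=
    hφ.comp_homeomorph (Homeomorph.smulOfNeZero c hc.ne')
  have hsm : ContDiff ℝ ∞ (fun x => φ (c • x)) := (φ.smooth ⊤).comp (contDiff_const_smul c)
  have key := integral_fourierL2_mul_schwartz (hu.toLp u) (hcs.toSchwartzMap hsm)
  have h1 : ∫ x, ((c ^ Module.finrank ℝ V)⁻¹ : ℝ) •
      (𝓕 (hu.toLp u) : Lp ℂ 2 (volume : Measure V)) (c⁻¹ • x) * φ x =
      ∫ x, (𝓕 (hu.toLp u) : Lp ℂ 2 (volume : Measure V)) x * φ (c • x) := by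
    have := Measure.integral_comp_smul (volume : Measure V)
      (fun x => (𝓕 (hu.toLp u) : Lp ℂ 2 (volume : Measure V)) x * φ (c • x)) c⁻¹
    simp only [smul_inv_smul₀ hc.ne'] at this
    simp only [smul_mul_assoc]
    rw [integral_smul, this, abs_of_pos (by positivity), smul_smul, inv_pow, inv_inv,
      inv_mul_cancel₀ (pow_ne_zero _ hc.ne'), one_smul]
  have h2 : ∫ x, (huc.toLp _) x * 𝓕 (φ : V → ℂ) x = ∫ x, u (c • x) * 𝓕 (φ : V → ℂ) x := by
    refine integral_congr_ae ?_
    filter_upwards [huc.coeFn_toLp] with x hx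
    rw [hx]
  have h3 : ∫ x, (hu.toLp _) x * 𝓕 (fun x => φ (c • x)) x =
      ∫ x, u x * 𝓕 (fun x => φ (c • x)) x := by
    refine integral_congr_ae ?_
    filter_upwards [hu.coeFn_toLp] with x hx
    rw [hx]
  rw [integral_fourierL2_mul_schwartz, h2]
  refine h1.trans (key.trans (h3.trans ?_))
  simp only [fourier_comp_smul _ hc]
  have := Measure.integral_comp_smul (volume : Measure V)
    (fun x => u x * 𝓕 (φ : V → ℂ) (c⁻¹ • x)) c
  simp only [inv_smul_smul₀ hc.ne'] at this
  rw [this, abs_of_pos (by positivity), ← integral_smul]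
  simp only [mul_smul_comm]

end FourierL2

/-- The two factors `(2π)^(-n/2)` multiply to the Jacobian of the dilation by `2π`, which absorbs
all normalizing constants. From here on g is simply `𝓕` of `f(2π ·)`. -/
theorem density_ae_eq {f : EuclideanSpace ℝ (Fin n) → ℂ} (hf : MemLp f 2)
    (hf' : MemLp (fun x => f ((2 * Real.pi) • x)) 2) :
    density f hf =ᵐ[volume]
      (𝓕 (hf'.toLp _) : Lp ℂ 2 (volume : Measure (EuclideanSpace ℝ (Fin n)))) := by
  filter_upwards [fourierL2_comp_smul hf Real.two_pi_pos hf'] with x hx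
  rw [← hx, density, invFourier, ← mul_assoc, ← Complex.ofReal_mul,
    ← Real.rpow_add Real.two_pi_pos, Complex.real_smul]
  congr 2
  rw [show -(n : ℝ) / 2 + -(n : ℝ) / 2 = -(n : ℝ) by ring, Real.rpow_neg Real.two_pi_pos.le,
    Real.rpow_natCast]
  simp

/-! ### Derivatives of the sequence -/

theorem iterate_pderiv_monomial (j : Fin n) (k : ℕ) (α : Fin n →₀ ℕ) (a : ℝ) :
    (fun r => MvPolynomial.pderiv j r)^[k] (MvPolynomial.monomial α a) =
      MvPolynomial.monomial (α - Finsupp.single j k) (a * ((α j).descFactorial k : ℝ)) := by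
  induction k with
  | zero => simp
  | succ k ih =>
    rw [Function.iterate_succ_apply', ih, MvPolynomial.pderiv_monomial]
    congr 1
    · rw [tsub_tsub, ← Finsupp.single_add]
    · simp only [Finsupp.coe_tsub, Pi.sub_apply, Finsupp.single_eq_same, Nat.descFactorial_succ]
      push_cast
      ring

theorem foldr_pderiv_monomial (β : Fin n →₀ ℕ) (α : Fin n →₀ ℕ) (l : List (Fin n))
    (hl : l.Nodup) :
    l.foldr (fun j q => (fun r => MvPolynomial.pderiv j r)^[β j] q)
        (MvPolynomial.monomial α (1 : ℝ)) =
      MvPolynomial.monomial (α - ∑ j ∈ l.toFinset, Finsupp.single j (β j))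
        (∏ j ∈ l.toFinset, ((α j).descFactorial (β j) : ℝ)) := by
  induction l with
  | nil => simp
  | cons j l ih =>
    have hj : j ∉ l.toFinset := by simpa using (List.nodup_cons.1 hl).1
    rw [List.foldr_cons, ih (List.nodup_cons.1 hl).2, iterate_pderiv_monomial]
    rw [List.toFinset_cons, Finset.sum_insert hj, Finset.prod_insert hj, tsub_tsub, add_comm]
    congr 1
    have h0 : (∑ i ∈ l.toFinset, Finsupp.single i (β i)) j = 0 := by
      rw [Finsupp.finsetSum_apply]
      refine Finset.sum_eq_zero fun i hi => ?_
      rw [Finsupp.single_apply, if_neg]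
      rintro rfl
      exact hj hi
    rw [Finsupp.coe_tsub, Pi.sub_apply, h0, tsub_zero, mul_comm]

theorem polyDeriv_monomial (β α : Fin n →₀ ℕ) :
    polyDeriv β (MvPolynomial.monomial α 1) =
      MvPolynomial.monomial (α - β) (∏ j, ((α j).descFactorial (β j) : ℝ)) := by
  rw [polyDeriv, foldr_pderiv_monomial _ _ _ (List.nodup_finRange n)]
  have : (List.finRange n).toFinset = Finset.univ := by ext; simp
  rw [this, Finsupp.univ_sum_single]

theorem riesz_monomial (s : (Fin n →₀ ℕ) → ℝ) (α : Fin n →₀ ℕ) (a : ℝ) :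
    riesz s (MvPolynomial.monomial α a) = a * s α := by
  have : MvPolynomial.monomial α a = a • MvPolynomial.basisMonomials (Fin n) ℝ α := by
    simp [MvPolynomial.smul_monomial]
  rw [this, map_smul, riesz, Module.Basis.constr_basis, smul_eq_mul]

theorem momentDeriv_apply (β : Fin n →₀ ℕ) (s : (Fin n →₀ ℕ) → ℝ) (α : Fin n →₀ ℕ) :
    momentDeriv β s α =
      (-1) ^ β.degree * ((∏ j, ((α j).descFactorial (β j) : ℝ)) * s (α - β)) := by
  rw [momentDeriv, polyDeriv_monomial, riesz_monomial]

theorem momentDeriv_zero (s : (Fin n →₀ ℕ) → ℝ) : momentDeriv 0 s = s := by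
  ext α
  simp [momentDeriv_apply]

/-! ### The characteristic power series -/

/-- The falling factorial produced by `∂^β` turns `(α + β)!` into `α!`, while `(-1)^|β| i^|β|`
becomes `(-i)^|β|`. -/
theorem charTerm_momentDeriv_add (β : Fin n →₀ ℕ) (s : (Fin n →₀ ℕ) → ℝ) (z : Fin n → ℂ)
    (α : Fin n →₀ ℕ) :
    charTerm (momentDeriv β s) z (α + β) =
      (-Complex.I) ^ β.degree * (∏ j, z j ^ β j) * charTerm s z α := by
  have hfac : (∏ j, (((α + β) j).factorial : ℂ)) =
      (∏ j, ((α j).factorial : ℂ)) * ∏ j, (((α + β) j).descFactorial (β j) : ℂ) := by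
    rw [← Finset.prod_mul_distrib]
    refine Finset.prod_congr rfl fun j _ => ?_
    rw [← Nat.factorial_mul_descFactorial (n := (α + β) j) (k := β j) (by simp)]
    simp
  have h1 : (∏ j, ((α j).factorial : ℂ)) ≠ 0 :=
    Finset.prod_ne_zero_iff.2 fun j _ => Nat.cast_ne_zero.2 (Nat.factorial_ne_zero _)
  have h2 : (∏ j, (((α + β) j).descFactorial (β j) : ℂ)) ≠ 0 :=
    Finset.prod_ne_zero_iff.2 fun j _ => Nat.cast_ne_zero.2 (by
      rw [Ne, Nat.descFactorial_eq_zero_iff_lt]; simp)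
  rw [charTerm, charTerm, momentDeriv_apply, hfac, add_tsub_cancel_right]
  have hz : ∏ j, z j ^ (α + β) j = (∏ j, z j ^ α j) * ∏ j, z j ^ β j := by
    rw [← Finset.prod_mul_distrib]
    exact Finset.prod_congr rfl fun j _ => by rw [Finsupp.add_apply, pow_add]
  rw [hz, map_add Finsupp.degree, pow_add, neg_pow Complex.I]
  push_cast
  simp only [Finsupp.coe_add] at h2
  field_simp

theorem charTerm_momentDeriv_eq_zero {β α : Fin n →₀ ℕ} (h : ¬ β ≤ α) (s : (Fin n →₀ ℕ) → ℝ)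
    (z : Fin n → ℂ) : charTerm (momentDeriv β s) z α = 0 := by
  obtain ⟨j, hj⟩ : ∃ j, α j < β j := by
    by_contra hc
    push Not at hc
    exact h hc
  have : ∏ j, ((α j).descFactorial (β j) : ℝ) = 0 :=
    Finset.prod_eq_zero (Finset.mem_univ j) (by
      rw [Nat.descFactorial_eq_zero_iff_lt.2 hj, Nat.cast_zero])
  rw [charTerm, momentDeriv_apply, this]
  simp

/-- Only indices of the form `α + β` contribute, so the differentiated series is the original one
shifted. -/
theorem hasSum_charTerm_momentDeriv (β : Fin n →₀ ℕ) {s : (Fin n →₀ ℕ) → ℝ} {z : Fin n → ℂ}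
    {a : ℂ} (h : HasSum (charTerm s z) a) :
    HasSum (charTerm (momentDeriv β s) z) ((-Complex.I) ^ β.degree * (∏ j, z j ^ β j) * a) := by
  have hinj : Function.Injective fun α : Fin n →₀ ℕ => α + β := add_left_injective β
  refine (hinj.hasSum_iff ?_).1 ?_
  · intro α hα
    refine charTerm_momentDeriv_eq_zero (fun hle => hα ⟨α - β, ?_⟩) s z
    exact tsub_add_cancel_of_le hle
  · have : charTerm (momentDeriv β s) z ∘ (fun α => α + β) =
        fun α => (-Complex.I) ^ β.degree * (∏ j, z j ^ β j) * charTerm s z α :=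
      funext fun α => charTerm_momentDeriv_add β s z α
    rw [this]
    exact h.mul_left _

theorem IsEntireSeries.momentDeriv {s : (Fin n →₀ ℕ) → ℝ} (h : IsEntireSeries s)
    (β : Fin n →₀ ℕ) : IsEntireSeries (momentDeriv β s) :=
  fun z => (hasSum_charTerm_momentDeriv β (h z).hasSum).summable

theorem charSeries_momentDeriv {s : (Fin n →₀ ℕ) → ℝ} (h : IsEntireSeries s)
    (β : Fin n →₀ ℕ) (x : EuclideanSpace ℝ (Fin n)) :
    charSeries (MomentDensity.momentDeriv β s) x =
      (-Complex.I) ^ β.degree * ((monom β x : ℂ) * charSeries s x) := by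
  rw [charSeries, (hasSum_charTerm_momentDeriv β (h _).hasSum).tsum_eq, mul_assoc, monom]
  push_cast
  rfl

theorem memLp_charSeries_momentDeriv_iff {s : (Fin n →₀ ℕ) → ℝ} (h : IsEntireSeries s)
    (β : Fin n →₀ ℕ) :
    MemLp (charSeries (MomentDensity.momentDeriv β s)) 2 volume ↔
      MemLp (fun x => (monom β x : ℂ) * charSeries s x) 2 volume := by
  rw [funext (charSeries_momentDeriv h β)]
  have hne : (-Complex.I) ^ β.degree ≠ 0 := pow_ne_zero _ (neg_ne_zero.2 Complex.I_ne_zero)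
  refine ⟨fun hm => ?_, fun hm => hm.const_mul _⟩
  have := hm.const_mul ((-Complex.I) ^ β.degree)⁻¹
  simpa only [inv_mul_cancel_left₀ hne] using this

theorem norm_charTerm (s : (Fin n →₀ ℕ) → ℝ) (z : Fin n → ℂ) (α : Fin n →₀ ℕ) :
    ‖charTerm s z α‖ = |s α| / (∏ j, ((α j).factorial : ℝ)) * ∏ j, ‖z j‖ ^ α j := by
  simp [charTerm]

theorem continuous_charSeries {s : (Fin n →₀ ℕ) → ℝ} (h : IsEntireSeries s) :
    Continuous (charSeries s) := by
  rw [continuous_iff_continuousAt]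
  intro x
  have hc : ContinuousOn (charSeries s) (Metric.ball 0 (‖x‖ + 1)) := by
    refine continuousOn_tsum (u := fun α => ‖charTerm s (fun _ => ((‖x‖ + 1 : ℝ) : ℂ)) α‖)
      (fun α => ?_) (h _).norm fun α y hy => ?_
    · unfold charTerm
      fun_prop
    · rw [norm_charTerm, norm_charTerm]
      gcongr with j
      have h1 : ‖y j‖ ≤ ‖y‖ := PiLp.norm_apply_le y j
      have h2 : ‖y‖ < ‖x‖ + 1 := by simpa using hy
      rw [Complex.norm_real, Complex.norm_real,
        Real.norm_of_nonneg (r := ‖x‖ + 1) (by positivity)]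
      linarith
  exact hc.continuousAt (Metric.isOpen_ball.mem_nhds (by simp))

/-! ### Grouping multi-indices by degree -/

/-- The multi-indices of degree `k`. -/
def multiIndices (n k : ℕ) : Finset (Fin n →₀ ℕ) := Finset.univ.finsuppAntidiag k

theorem mem_multiIndices {k : ℕ} {α : Fin n →₀ ℕ} : α ∈ multiIndices n k ↔ α.degree = k := by
  simp [multiIndices, Finsupp.degree_eq_sum]

/-- The multinomial theorem over `multiIndices`. -/
theorem sum_mul_pow_eq {K : Type*} [Field K] [CharZero K] (x v : Fin n → K) (k : ℕ) :
    (∑ j, x j * v j) ^ k = ∑ α ∈ multiIndices n k,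
      (k.factorial : K) / (∏ j, ((α j).factorial : K)) * ((∏ j, x j ^ α j) * ∏ j, v j ^ α j) := by
  rw [Finset.sum_pow_eq_sum_piAntidiag]
  refine Finset.sum_bij' (fun a _ => Finsupp.equivFunOnFinite.symm a) (fun α _ => ⇑α)
    (fun a ha => ?_) (fun α hα => ?_) (fun a _ => rfl) (fun α _ => by simp) (fun a ha => ?_)
  · rw [mem_multiIndices, Finsupp.degree_eq_sum]
    simpa using ha
  · rw [mem_multiIndices, Finsupp.degree_eq_sum] at hα
    simpa using hα
  · have hs : ∑ j, a j = k := by simpa using ha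
    have h := Nat.multinomial_spec (Finset.univ : Finset (Fin n)) a
    rw [hs] at h
    have hne : (∏ j, ((a j).factorial : K)) ≠ 0 :=
      Finset.prod_ne_zero_iff.2 fun j _ => Nat.cast_ne_zero.2 (Nat.factorial_ne_zero _)
    simp only [Finsupp.equivFunOnFinite_symm_apply_apply]
    rw [← h, ← Finset.prod_mul_distrib]
    push_cast
    rw [mul_div_cancel_left₀ _ hne]
    simp only [mul_pow]

/-- Multi-indices are classified by their degree. -/
def sigmaMultiIndices (n : ℕ) : (Σ k, ↥(multiIndices n k)) ≃ (Fin n →₀ ℕ) where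
  toFun p := p.2
  invFun α := ⟨α.degree, α, mem_multiIndices.2 rfl⟩
  left_inv := by
    rintro ⟨k, α, hα⟩
    obtain rfl := mem_multiIndices.1 hα
    rfl
  right_inv _ := rfl

theorem hasSum_multiIndices {f : (Fin n →₀ ℕ) → ℂ} {a : ℂ} (h : HasSum f a) :
    HasSum (fun k => ∑ α ∈ multiIndices n k, f α) a :=
  HasSum.sigma ((sigmaMultiIndices n).hasSum_iff.2 h) fun k => (multiIndices n k).hasSum f

theorem summable_of_summable_multiIndices {f : (Fin n →₀ ℕ) → ℝ} (hf : ∀ α, 0 ≤ f α)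
    (h : Summable fun k => ∑ α ∈ multiIndices n k, f α) : Summable f := by
  refine (sigmaMultiIndices n).summable_iff.1 ?_
  refine (summable_sigma_of_nonneg fun p => hf _).2 ⟨fun k => (Set.toFinite _).summable _, ?_⟩
  refine h.congr fun k => ?_
  exact ((multiIndices n k).tsum_subtype f).symm

/-! ### Moments of measures on the line with smooth characteristic function -/

/-- In the sum of the second-order Taylor expansions at `c k` and `-c k` the linear terms cancel. -/
theorem tendsto_symmetric_second_difference {G : ℝ → ℂ} (h : ContDiff ℝ 2 G) {c : ℕ → ℝ}
    (hc0 : ∀ k, c k ≠ 0) (hc : Tendsto c atTop (𝓝 0)) :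
    Tendsto (fun k => ((c k ^ 2)⁻¹ : ℝ) • (G (c k) + G (-c k) - 2 * G 0)) atTop
      (𝓝 (iteratedDeriv 2 G 0)) := by
  have hT := taylor_tendsto convex_univ (Set.mem_univ (0 : ℝ)) h.contDiffOn
  rw [nhdsWithin_univ] at hT
  have h1 := hT.comp hc
  have hc' : Tendsto (fun k => -c k) atTop (𝓝 0) := by simpa using hc.neg
  have h2 := (h1.add (hT.comp hc')).const_add (iteratedDeriv 2 G 0)
  simp only [add_zero] at h2
  refine h2.congr fun k => ?_
  have hck : (c k : ℂ) ≠ 0 := Complex.ofReal_ne_zero.2 (hc0 k)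
  simp only [Function.comp_apply, taylor_within_apply, Finset.sum_range_succ,
    iteratedDerivWithin_univ, Complex.real_smul, Finset.range_zero, Finset.sum_empty,
    iteratedDeriv_zero, sub_zero]
  push_cast
  simp only [Nat.factorial]
  push_cast
  field_simp
  ring

/-- The second difference of the characteristic function is `-∫ 2(1 - cos(tx))`. Divided by `t²` it
has a finite limit, while the integrands `2(1 - cos(tx))/t²` are nonnegative and tend to `x²`; Fatou
concludes. -/
theorem integrable_sq_of_contDiff_charFun {ν : Measure ℝ} [IsFiniteMeasure ν]
    (h : ContDiff ℝ 2 (charFun ν)) : Integrable (fun x => x ^ 2) ν := by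
  set F := charFun ν
  set c : ℕ → ℝ := fun k => 1 / ((k : ℝ) + 1)
  have hc0 : ∀ k, c k ≠ 0 := fun k => by positivity
  have hc : Tendsto c atTop (𝓝 0) := tendsto_one_div_add_atTop_nhds_zero_nat
  have hint : ∀ t : ℝ, Integrable (fun x => Real.cos (t * x)) ν := fun t =>
    (integrable_const (1 : ℝ)).mono' (by fun_prop) (Eventually.of_forall fun x => by
      simpa using Real.abs_cos_le_one _)
  have hF : ∀ t, F t + F (-t) - 2 * F 0 = ((∫ x, -(2 * (1 - Real.cos (t * x))) ∂ν : ℝ) : ℂ) := by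
    intro t
    have he : ∀ t : ℝ, Integrable (fun x : ℝ => Complex.exp (t * x * Complex.I)) ν := fun t =>
      (integrable_const (1 : ℝ)).mono' (by fun_prop) (Eventually.of_forall fun x => by
        rw [← Complex.ofReal_mul, Complex.norm_exp_ofReal_mul_I])
    simp only [F, charFun_apply_real]
    have hadd : Integrable (fun x : ℝ => Complex.exp (t * x * Complex.I) +
        Complex.exp ((-t : ℝ) * x * Complex.I)) ν := (he t).add (he (-t))
    rw [← integral_const_mul, ← integral_add (he t) (he (-t)),
      ← integral_sub hadd ((he 0).const_mul 2), ← integral_complex_ofReal]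
    refine integral_congr_ae (Eventually.of_forall fun x => ?_)
    simp only [Complex.ofReal_neg, Complex.ofReal_mul, Complex.ofReal_sub, Complex.ofReal_cos,
      Complex.cos]
    simp
    ring
  have hlim : Tendsto (fun k => (c k ^ 2)⁻¹ * ∫ x, 2 * (1 - Real.cos (c k * x)) ∂ν) atTop
      (𝓝 (-(iteratedDeriv 2 F 0).re)) := by
    have h1 := ((Complex.continuous_re.tendsto _).comp
      (tendsto_symmetric_second_difference h hc0 hc)).neg
    refine h1.congr fun k => ?_
    rw [Function.comp_apply, hF, Complex.smul_re, Complex.ofReal_re, integral_neg]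
    simp
  have hnn : ∀ k x, 0 ≤ (c k ^ 2)⁻¹ * (2 * (1 - Real.cos (c k * x))) := fun k x => by
    have := Real.cos_le_one (c k * x)
    have : 0 ≤ 1 - Real.cos (c k * x) := by linarith
    positivity
  have hpt : ∀ x : ℝ, Tendsto (fun k => (c k ^ 2)⁻¹ * (2 * (1 - Real.cos (c k * x)))) atTop
      (𝓝 (x ^ 2)) := by
    intro x
    have hd (t : ℝ) : HasDerivAt (fun t : ℝ => Complex.cos (t * x)) (-Complex.sin (t * x) * x) t :=
      ((Complex.hasDerivAt_cos _).comp (t : ℂ) (hasDerivAt_mul_const (x : ℂ))).comp_ofReal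
    have hd' : HasDerivAt (fun t : ℝ => -Complex.sin (t * x) * x)
        (-(Complex.cos ((0 : ℝ) * x) * x) * x) 0 :=
      ((((Complex.hasDerivAt_sin _).comp ((0 : ℝ) : ℂ)
        (hasDerivAt_mul_const (x : ℂ))).comp_ofReal).neg).mul_const _
    -- The pointwise limit is the same second-difference lemma, now applied to `t ↦ cos(tx)`, whose
    -- second derivative at 0 is `-x²`.
    have h1 := ((Complex.continuous_re.tendsto _).comp
      (tendsto_symmetric_second_difference (G := fun t : ℝ => Complex.cos (t * x))
        ((Complex.contDiff_cos.restrict_scalars ℝ).comp (Complex.ofRealCLM.contDiff.mul contDiff_const)) hc0 hc)).neg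
    have e2 : iteratedDeriv 2 (fun t : ℝ => Complex.cos (t * x)) 0 = ((-x ^ 2 : ℝ) : ℂ) := by
      rw [iteratedDeriv_succ, iteratedDeriv_one, funext fun t => (hd t).deriv, hd'.deriv]
      simp
      ring
    rw [e2, Complex.ofReal_re, neg_neg] at h1
    refine h1.congr fun k => ?_
    rw [Function.comp_apply, Complex.smul_re]
    simp [← Complex.ofReal_mul, ← Complex.ofReal_cos]
    ring
  refine ⟨by fun_prop, ?_⟩
  rw [hasFiniteIntegral_iff_ofReal (Eventually.of_forall fun x => sq_nonneg x)]
  calc ∫⁻ x, ENNReal.ofReal (x ^ 2) ∂ν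
      = ∫⁻ x, liminf (fun k => ENNReal.ofReal
          ((c k ^ 2)⁻¹ * (2 * (1 - Real.cos (c k * x))))) atTop ∂ν :=
        lintegral_congr fun x => ((ENNReal.tendsto_ofReal (hpt x)).liminf_eq).symm
    _ ≤ liminf (fun k => ∫⁻ x, ENNReal.ofReal
          ((c k ^ 2)⁻¹ * (2 * (1 - Real.cos (c k * x)))) ∂ν) atTop :=
        lintegral_liminf_le fun k => by fun_prop
    _ = ENNReal.ofReal (-(iteratedDeriv 2 F 0).re) := by
        refine Tendsto.liminf_eq ((ENNReal.tendsto_ofReal hlim).congr fun k => ?_)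
        rw [← integral_const_mul, ofReal_integral_eq_lintegral_ofReal _
          (Eventually.of_forall (hnn k))]
        exact (((integrable_const 1).sub (hint (c k))).const_mul 2).const_mul _
    _ < ⊤ := ENNReal.ofReal_lt_top

/-- Induction on `k` over all measures at once: `x² dν` is finite by the previous lemma and its
characteristic function is minus the second derivative of that of `ν`, hence again smooth. -/
theorem integrable_pow_of_contDiff_charFun (k : ℕ) : ∀ (ν : Measure ℝ) [IsFiniteMeasure ν],
    ContDiff ℝ ∞ (charFun ν) → Integrable (fun x => x ^ (2 * k)) ν := by
  induction k with
  | zero => intro ν _ _; simp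
  | succ k ih =>
    intro ν _ h
    have h2 := integrable_sq_of_contDiff_charFun (h.of_le (by norm_cast))
    set w : ℝ → NNReal := fun x => (x ^ 2).toNNReal
    have hw : Measurable w := by fun_prop
    set ν' := ν.withDensity fun x => (w x : ℝ≥0∞)
    have hfin : IsFiniteMeasure ν' := isFiniteMeasure_withDensity_ofReal h2.hasFiniteIntegral
    have hchar : charFun ν' = fun t => -iteratedDeriv 2 (charFun ν) t := by
      ext t
      have hL : MemLp id (2 : ℕ) ν := by
        rw [Nat.cast_ofNat, memLp_two_iff_integrable_sq (by fun_prop)]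
        exact h2
      rw [iteratedDeriv_charFun hL, charFun_apply_real,
        integral_withDensity_eq_integral_smul hw]
      rw [Complex.I_sq, neg_one_mul, neg_neg]
      refine integral_congr_ae (Eventually.of_forall fun x => ?_)
      simp [w, NNReal.smul_def, Real.coe_toNNReal _ (sq_nonneg x)]
    have h' : ContDiff ℝ ∞ (charFun ν') := by
      rw [hchar]
      have h3 : ContDiff ℝ ∞ (deriv^[2] (charFun ν)) := h.iterate_deriv 2
      rw [← iteratedDeriv_eq_iterate] at h3
      exact h3.neg
    have := ih ν' h'
    rw [integrable_withDensity_iff_integrable_smul hw] at this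
    refine this.congr (Eventually.of_forall fun x => ?_)
    simp only [w, NNReal.smul_def, Real.coe_toNNReal _ (sq_nonneg x), smul_eq_mul]
    ring

theorem memLp_id_of_contDiff_charFun {ν : Measure ℝ} [IsFiniteMeasure ν]
    (h : ContDiff ℝ ∞ (charFun ν)) (k : ℕ) : MemLp id k ν := by
  rcases Nat.eq_zero_or_pos k with rfl | hk
  · simpa using aestronglyMeasurable_id
  have h2 : MemLp id (2 * k : ℕ) ν := by
    refine (integrable_norm_rpow_iff (by fun_prop)
      (by simpa using hk.ne') (ENNReal.natCast_ne_top _)).1 ?_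
    rw [ENNReal.toReal_natCast]
    refine (integrable_pow_of_contDiff_charFun k ν h).congr (Eventually.of_forall fun x => ?_)
    simp only [Real.rpow_natCast, id, Real.norm_eq_abs, pow_mul, sq_abs]
  exact h2.mono_exponent (by exact_mod_cast (by lia : k ≤ 2 * k))

/-- A finite measure on the line whose characteristic function is an everywhere convergent power
series has the moments which are read off from the coefficients. -/
theorem moments_of_hasSum_charFun {ν : Measure ℝ} [IsFiniteMeasure ν] {c : ℕ → ℂ}
    (h : ∀ t : ℝ, HasSum (fun k => c k * (t : ℂ) ^ k) (charFun ν t)) (k : ℕ) :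
    Integrable (fun x => x ^ k) ν ∧
      (k.factorial : ℂ) * c k = Complex.I ^ k * ((∫ x, x ^ k ∂ν : ℝ) : ℂ) := by
  let p : FormalMultilinearSeries ℝ ℝ ℂ := fun k =>
    ContinuousMultilinearMap.mkPiRing ℝ (Fin k) (c k)
  have hpn : ∀ k, ‖p k‖ = ‖c k‖ := fun k => ContinuousMultilinearMap.norm_mkPiRing _
  have hr : p.radius = ⊤ := by
    refine p.radius_eq_top_of_summable_norm fun r => ?_
    refine (h r).summable.norm.congr fun k => ?_
    simp [hpn]
  have hF : HasFPowerSeriesOnBall (charFun ν) p 0 ⊤ := by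
    refine ⟨hr.ge, ENNReal.zero_lt_top, fun {t} _ => ?_⟩
    rw [zero_add]
    refine (h t).congr_fun fun k => ?_
    simp [p, mul_comm]
  have hsmooth : ContDiff ℝ ∞ (charFun ν) := by
    have : AnalyticOnNhd ℝ (charFun ν) Set.univ := by
      simpa using hF.analyticOnNhd
    exact contDiffOn_univ.1 (this.contDiffOn uniqueDiffOn_univ)
  have hL := memLp_id_of_contDiff_charFun hsmooth k
  refine ⟨?_, ?_⟩
  · have := hL.integrable_norm_pow'
    refine this.mono' (by fun_prop) (Eventually.of_forall fun x => ?_)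
    simp
  · have h1 := hF.factorial_smul 1 k
    rw [← iteratedDeriv_eq_iteratedFDeriv, iteratedDeriv_charFun_zero hL] at h1
    rw [← h1]
    simp [p]

/-! ### From moments along lines to moments of all multi-indices. -/

theorem continuous_monom (α : Fin n →₀ ℕ) : Continuous (monom α) := by
  unfold monom
  fun_prop

theorem abs_monom_le (α : Fin n →₀ ℕ) (x : EuclideanSpace ℝ (Fin n)) :
    |monom α x| ≤ 1 + ∑ j, x j ^ (2 * α.degree) := by
  have hnn : ∀ j, 0 ≤ x j ^ (2 * α.degree) := fun j => by rw [pow_mul]; positivity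
  rcases isEmpty_or_nonempty (Fin n) with hn | hn
  · simp [monom]
  obtain ⟨i, hi⟩ := Finite.exists_max fun j => |x j|
  have h1 : |monom α x| ≤ |x i| ^ α.degree := by
    rw [monom, Finset.abs_prod, Finsupp.degree_eq_sum, ← Finset.prod_pow_eq_pow_sum]
    refine Finset.prod_le_prod (fun j _ => abs_nonneg _) fun j _ => ?_
    rw [abs_pow]
    exact pow_le_pow_left₀ (abs_nonneg _) (hi j) _
  have h2 : |x i| ^ α.degree ≤ 1 + x i ^ (2 * α.degree) := by
    rw [mul_comm, pow_mul, ← sq_abs, abs_pow]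
    nlinarith [sq_nonneg (|x i| ^ α.degree - 1)]
  have h3 := Finset.single_le_sum (fun j _ => hnn j) (Finset.mem_univ i)
  linarith

theorem charFun_map_inner {μ : Measure (EuclideanSpace ℝ (Fin n))}
    (v : EuclideanSpace ℝ (Fin n)) (t : ℝ) :
    charFun (μ.map fun x => ∑ j, x j * v j) t = charFun μ (t • v) := by
  rw [charFun_apply_real, charFun_apply, integral_map (by fun_prop) (by fun_prop)]
  refine integral_congr_ae (Eventually.of_forall fun x => ?_)
  simp only [PiLp.inner_apply]
  simp [Finset.mul_sum]
  congr 2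
  refine Finset.sum_congr rfl fun j _ => ?_
  ring

theorem charTerm_smul (s : (Fin n →₀ ℕ) → ℝ) (z : Fin n → ℂ) (t : ℂ) (α : Fin n →₀ ℕ) :
    charTerm s (fun j => t * z j) α = charTerm s z α * t ^ α.degree := by
  simp only [charTerm, mul_pow, Finset.prod_mul_distrib, Finsupp.degree_eq_sum,
    Finset.prod_pow_eq_pow_sum]
  ring

theorem coeff_sum_monomial (k : ℕ) (a : (Fin n →₀ ℕ) → ℝ) {α : Fin n →₀ ℕ}
    (hα : α ∈ multiIndices n k) :
    MvPolynomial.coeff α (∑ β ∈ multiIndices n k, MvPolynomial.monomial β (a β)) = a α := by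
  rw [MvPolynomial.coeff_sum]
  simp [MvPolynomial.coeff_monomial, hα]

/-- A finite measure whose characteristic function is the entire series of `s` represents `s`. -/
theorem represents_of_charFun_eq {μ : Measure (EuclideanSpace ℝ (Fin n))} [IsFiniteMeasure μ]
    {s : (Fin n →₀ ℕ) → ℝ} (hs : IsEntireSeries s) (h : ∀ z, charFun μ z = charSeries s z) :
    Represents μ s := by
  -- The image of `μ` under `x ↦ ⟨x, v⟩` has characteristic function `t ↦ f(tv)`, whose coefficient
  -- of `t^k` is the degree-`k` part of the series at `v`.
  have hline (v : EuclideanSpace ℝ (Fin n)) (k : ℕ) :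
      Integrable (fun x : EuclideanSpace ℝ (Fin n) => (∑ j, x j * v j) ^ k) μ ∧
      (k.factorial : ℂ) * ∑ α ∈ multiIndices n k, charTerm s (fun j => v j) α =
        Complex.I ^ k * ((∫ x, (∑ j, x j * v j) ^ k ∂μ : ℝ) : ℂ) := by
    have hm : Measurable fun x : EuclideanSpace ℝ (Fin n) => ∑ j, x j * v j := by fun_prop
    have := moments_of_hasSum_charFun (ν := μ.map fun x => ∑ j, x j * v j)
      (c := fun k => ∑ α ∈ multiIndices n k, charTerm s (fun j => v j) α) (fun t => ?_) k
    · rw [integrable_map_measure (by fun_prop) hm.aemeasurable,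
        integral_map hm.aemeasurable (by fun_prop)] at this
      exact this
    · rw [charFun_map_inner, h, charSeries]
      have := hasSum_multiIndices (hs fun j => (((t • v) j : ℝ) : ℂ)).hasSum
      refine this.congr_fun fun k => ?_
      rw [Finset.sum_mul]
      refine Finset.sum_congr rfl fun α hα => ?_
      rw [← mem_multiIndices.1 hα, ← charTerm_smul]
      simp
  have hcoord (j : Fin n) (k : ℕ) :
      Integrable (fun x : EuclideanSpace ℝ (Fin n) => x j ^ k) μ := by
    refine (hline (EuclideanSpace.single j 1) k).1.congr (Eventually.of_forall fun x => ?_)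
    simp
  have hint (α : Fin n →₀ ℕ) : Integrable (monom α) μ := by
    refine ((integrable_const (1 : ℝ)).add
      (integrable_finsetSum Finset.univ fun j _ => hcoord j (2 * α.degree))).mono'
      (continuous_monom α).aestronglyMeasurable (Eventually.of_forall fun x => ?_)
    simpa using abs_monom_le α x
  refine fun α => ⟨hint α, ?_⟩
  set k := α.degree with hk
  have hα : α ∈ multiIndices n k := mem_multiIndices.2 hk.symm
  -- As functions of `v`, both sides of `hline` are homogeneous polynomials of degree `k`. Equality
  -- for every `v` forces equality of coefficients, which isolates the single index `α`.
  have hpoly : (∑ β ∈ multiIndices n k,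
        MvPolynomial.monomial β ((∏ j, ((β j).factorial : ℝ))⁻¹ * s β)) =
      ∑ β ∈ multiIndices n k,
        MvPolynomial.monomial β ((∏ j, ((β j).factorial : ℝ))⁻¹ * ∫ x, monom β x ∂μ) := by
    refine MvPolynomial.funext fun v => ?_
    have hv := (hline (WithLp.toLp 2 v) k).2
    have hI : (Complex.I ^ k : ℂ) ≠ 0 := pow_ne_zero _ Complex.I_ne_zero
    have hL : ∑ β ∈ multiIndices n k, charTerm s (fun j => (v j : ℂ)) β =
        Complex.I ^ k * ((∑ β ∈ multiIndices n k,
          (∏ j, ((β j).factorial : ℝ))⁻¹ * s β * ∏ j, v j ^ β j : ℝ) : ℂ) := by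
      push_cast
      rw [Finset.mul_sum]
      refine Finset.sum_congr rfl fun β hβ => ?_
      rw [charTerm, mem_multiIndices.1 hβ]
      field_simp
    have hR : ∫ x : EuclideanSpace ℝ (Fin n), (∑ j, x j * v j) ^ k ∂μ =
        (k.factorial : ℝ) * ∑ β ∈ multiIndices n k,
          (∏ j, ((β j).factorial : ℝ))⁻¹ * (∫ x, monom β x ∂μ) * ∏ j, v j ^ β j := by
      simp only [sum_mul_pow_eq]
      rw [integral_finsetSum, Finset.mul_sum]
      · refine Finset.sum_congr rfl fun β _ => ?_
        rw [integral_const_mul, integral_mul_const]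
        simp only [monom]
        field_simp
      · exact fun β _ => ((hint β).mul_const _).const_mul _
    simp only at hv
    rw [hL, hR, mul_left_comm] at hv
    have hv' := mul_left_cancel₀ hI hv
    rw [Complex.ofReal_mul, Complex.ofReal_natCast] at hv'
    have := Complex.ofReal_injective
      (mul_left_cancel₀ (Nat.cast_ne_zero.2 k.factorial_ne_zero) hv')
    simpa [MvPolynomial.eval_monomial, Finsupp.prod_fintype] using this
  have hc := congrArg (MvPolynomial.coeff α) hpoly
  rw [coeff_sum_monomial _ _ hα, coeff_sum_monomial _ _ hα] at hc
  have hne : (∏ j, ((α j).factorial : ℝ))⁻¹ ≠ 0 :=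
    inv_ne_zero (Finset.prod_ne_zero_iff.2 fun j _ =>
      Nat.cast_ne_zero.2 (Nat.factorial_ne_zero _))
  exact (mul_left_cancel₀ hne hc).symm

/-! ### Growth of the even moments and the support -/

theorem tendsto_mul_rpow_one_div {δ : ℝ} (hδ : 0 < δ) (a : ℝ) :
    Tendsto (fun k : ℕ => a * δ ^ (1 / (2 * (k : ℝ)))) atTop (𝓝 a) := by
  have h1 : Tendsto (fun k : ℕ => 1 / (2 * (k : ℝ))) atTop (𝓝 0) := by
    simpa using (tendsto_inv_atTop_nhds_zero_nat (𝕜 := ℝ)).mul_const (2⁻¹ : ℝ)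
  have h2 := (Real.continuousAt_const_rpow (b := 0) hδ.ne').tendsto.comp h1
  simpa using h2.const_mul a

theorem rpow_one_div_pow_mul {a δ : ℝ} (ha : 0 ≤ a) (hδ : 0 ≤ δ) {k : ℕ} (hk : k ≠ 0) :
    (a ^ (2 * k) * δ) ^ (1 / (2 * (k : ℝ))) = a * δ ^ (1 / (2 * (k : ℝ))) := by
  rw [Real.mul_rpow (by positivity) hδ, one_div,
    show (2 * (k : ℝ))⁻¹ = ((2 * k : ℕ) : ℝ)⁻¹ by push_cast; rfl,
    Real.pow_rpow_inv_natCast ha (by positivity)]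

section Line

variable {Ω : Type*} [MeasurableSpace Ω] {μ : Measure Ω} [IsFiniteMeasure μ] {y : Ω → ℝ}

/-- By Markov, the 2k-th moment is at least `a^(2k) δ`, where `δ > 0` is the mass of `{|y| > a}`,
and `δ^(1/(2k)) → 1`. -/
theorem eventually_lt_rpow_moment (hint : ∀ k, Integrable (fun x => y x ^ (2 * k)) μ) {a a' : ℝ} (ha : 0 ≤ a)
    (hμ : μ {x | a < |y x|} ≠ 0) (haa : a' < a) :
    ∀ᶠ k : ℕ in atTop, a' < (∫ x, y x ^ (2 * k) ∂μ) ^ (1 / (2 * (k : ℝ))) := by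
  set δ := μ.real {x | a < |y x|}
  have hδ : 0 < δ := ENNReal.toReal_pos hμ (measure_ne_top _ _)
  filter_upwards [(tendsto_mul_rpow_one_div hδ a).eventually_const_lt haa, eventually_ne_atTop 0]
    with k hk hk0
  refine hk.trans_le ?_
  rw [← rpow_one_div_pow_mul ha hδ.le hk0]
  refine Real.rpow_le_rpow (by positivity) ?_ (by positivity)
  have hnn : ∀ x, 0 ≤ y x ^ (2 * k) := fun x => by rw [pow_mul]; positivity
  have h1 := mul_meas_ge_le_integral_of_nonneg (Eventually.of_forall hnn) (hint k) (a ^ (2 * k))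
  refine le_trans ?_ h1
  refine mul_le_mul_of_nonneg_left (measureReal_mono fun x hx => ?_) (by positivity)
  have hx' : a < |y x| := hx
  change a ^ (2 * k) ≤ y x ^ (2 * k)
  rw [← (even_two_mul k).pow_abs (y x)]
  exact pow_le_pow_left₀ ha hx'.le _

theorem eventually_rpow_moment_lt (hint : ∀ k, Integrable (fun x => y x ^ (2 * k)) μ)
    {b b' : ℝ} (hb : 0 ≤ b) (hμ : ∀ᵐ x ∂μ, |y x| ≤ b) (hbb : b < b') :
    ∀ᶠ k : ℕ in atTop, (∫ x, y x ^ (2 * k) ∂μ) ^ (1 / (2 * (k : ℝ))) < b' := by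
  -- The summand 1 keeps `C` positive when `μ = 0`, so that `C^(1/(2k)) → 1` still holds.
  set C := μ.real Set.univ + 1
  have hC : 0 < C := by positivity
  filter_upwards [(tendsto_mul_rpow_one_div hC b).eventually_lt_const hbb, eventually_ne_atTop 0]
    with k hk hk0
  refine lt_of_le_of_lt ?_ hk
  rw [← rpow_one_div_pow_mul hb hC.le hk0]
  have hnn : ∀ x, 0 ≤ y x ^ (2 * k) := fun x => by rw [pow_mul]; positivity
  refine Real.rpow_le_rpow (integral_nonneg hnn) ?_ (by positivity)
  calc ∫ x, y x ^ (2 * k) ∂μ ≤ ∫ _, b ^ (2 * k) ∂μ := by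
        refine integral_mono_ae (hint k) (integrable_const _) ?_
        filter_upwards [hμ] with x hx
        rw [← (even_two_mul k).pow_abs (y x)]
        exact pow_le_pow_left₀ (abs_nonneg _) hx _
    _ ≤ b ^ (2 * k) * C := by
        rw [integral_const, smul_eq_mul, mul_comm]
        exact mul_le_mul_of_nonneg_left (by simp [C]) (by positivity)

theorem exists_tendsto_rpow_moment (hint : ∀ k, Integrable (fun x => y x ^ (2 * k)) μ) {c : ℝ} (hc : 0 ≤ c)
    (hμ : ∀ᵐ x ∂μ, |y x| ≤ c) :
    ∃ l ≤ c, Tendsto (fun k : ℕ => (∫ x, y x ^ (2 * k) ∂μ) ^ (1 / (2 * (k : ℝ)))) atTop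
      (𝓝 l) := by
  -- The limit is the essential supremum of `|y|`, realized as the infimum of the nonnegative
  -- almost-everywhere bounds.
  set S := {b : ℝ | 0 ≤ b ∧ ∀ᵐ x ∂μ, |y x| ≤ b}
  have hS : BddBelow S := ⟨0, fun b hb => hb.1⟩
  have hcS : c ∈ S := ⟨hc, hμ⟩
  refine ⟨sInf S, csInf_le hS hcS, tendsto_order.2 ⟨fun a' ha' => ?_, fun b' hb' => ?_⟩⟩
  · rcases lt_or_ge a' 0 with h0 | h0
    · refine Eventually.of_forall fun k => h0.trans_le (Real.rpow_nonneg ?_ _)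
      exact integral_nonneg fun x => by simp only [pow_mul]; positivity
    · obtain ⟨a, ha1, ha2⟩ := exists_between ha'
      have ha : 0 ≤ a := h0.trans ha1.le
      refine eventually_lt_rpow_moment hint ha (fun h => ?_) ha1
      refine ha2.not_ge (csInf_le hS ⟨ha, ?_⟩)
      rw [ae_iff]
      simpa using h
  · obtain ⟨b, hbS, hb⟩ := exists_lt_of_csInf_lt ⟨c, hcS⟩ hb'
    exact eventually_rpow_moment_lt hint hbS.1 hbS.2 hb

theorem ae_abs_le_of_tendsto_rpow_moment (hint : ∀ k, Integrable (fun x => y x ^ (2 * k)) μ) {c l : ℝ} (hc : 0 ≤ c) (hl : l ≤ c)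
    (h : Tendsto (fun k : ℕ => (∫ x, y x ^ (2 * k) ∂μ) ^ (1 / (2 * (k : ℝ)))) atTop (𝓝 l)) :
    ∀ᵐ x ∂μ, |y x| ≤ c := by
  have key : ∀ m : ℕ, ∀ᵐ x ∂μ, |y x| ≤ c + 1 / ((m : ℝ) + 1) := by
    intro m
    have hm : (0 : ℝ) < 1 / ((m : ℝ) + 1) := by positivity
    rw [ae_iff]
    by_contra hne
    simp only [not_le] at hne
    obtain ⟨a', h1, h2⟩ := exists_between (show c < c + 1 / ((m : ℝ) + 1) by linarith)
    have e1 := eventually_lt_rpow_moment hint (by positivity) hne h2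
    have e2 := h.eventually_lt_const (hl.trans_lt h1)
    obtain ⟨k, hk1, hk2⟩ := (e1.and e2).exists
    exact lt_asymm hk1 hk2
  filter_upwards [ae_all_iff.2 key] with x hx
  have := tendsto_one_div_add_atTop_nhds_zero_nat (𝕜 := ℝ)
  refine ge_of_tendsto (by simpa using this.const_add c) (Eventually.of_forall hx)

end Line

theorem monom_single (j : Fin n) (k : ℕ) (x : EuclideanSpace ℝ (Fin n)) :
    monom (Finsupp.single j k) x = x j ^ k := by
  rw [monom, Finset.prod_eq_single j]
  · simp
  · intro i _ hi
    simp [Finsupp.single_eq_of_ne hi]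
  · simp

theorem Represents.isFiniteMeasure {μ : Measure (EuclideanSpace ℝ (Fin n))}
    {s : (Fin n →₀ ℕ) → ℝ} (h : Represents μ s) : IsFiniteMeasure μ := by
  have h0 := (h 0).1
  have : monom (0 : Fin n →₀ ℕ) = fun _ => 1 := by ext; simp [monom]
  rw [this, integrable_const_iff] at h0
  simpa using h0

theorem Represents.integrable_pow {μ : Measure (EuclideanSpace ℝ (Fin n))}
    {s : (Fin n →₀ ℕ) → ℝ} (h : Represents μ s) (j : Fin n) (k : ℕ) :
    Integrable (fun x : EuclideanSpace ℝ (Fin n) => x j ^ k) μ := by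
  simpa only [← monom_single] using (h (Finsupp.single j k)).1

theorem Represents.integral_pow {μ : Measure (EuclideanSpace ℝ (Fin n))}
    {s : (Fin n →₀ ℕ) → ℝ} (h : Represents μ s) (j : Fin n) (k : ℕ) :
    ∫ x, x j ^ k ∂μ = s (Finsupp.single j k) := by
  simpa only [← monom_single] using (h (Finsupp.single j k)).2

/-- A representing measure lives on the cube `[-c, c]ⁿ` exactly if the moments grow at most like
the powers of `c`. -/
theorem Represents.momentGrowth_iff {μ : Measure (EuclideanSpace ℝ (Fin n))}
    {s : (Fin n →₀ ℕ) → ℝ} (h : Represents μ s) {c : ℝ} (hc : 0 ≤ c) :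
    MomentGrowth c s ↔ ∀ᵐ x ∂μ, ∀ j, x j ∈ Set.Icc (-c) c := by
  have := h.isFiniteMeasure
  simp only [MomentGrowth, Set.mem_Icc, ← abs_le, ← h.integral_pow]
  rw [ae_all_iff]
  refine forall_congr' fun j => ⟨fun ⟨l, hl, ht⟩ => ?_, fun ha => ?_⟩
  · exact ae_abs_le_of_tendsto_rpow_moment (fun k => h.integrable_pow j _) hc hl ht
  · exact exists_tendsto_rpow_moment (fun k => h.integrable_pow j _) hc ha

/-! ### Measures on cubes -/

/-- By the multinomial theorem the terms of degree `k` add up to `(∑ r_j)^k / k!`, a term of an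
exponential series. -/
theorem summable_prod_pow_div_factorial (r : Fin n → ℝ) (hr : ∀ j, 0 ≤ r j) :
    Summable fun α : Fin n →₀ ℕ => (∏ j, r j ^ α j) / ∏ j, ((α j).factorial : ℝ) := by
  have hpos (α : Fin n →₀ ℕ) : 0 ≤ ∏ j, r j ^ α j :=
    Finset.prod_nonneg fun j _ => pow_nonneg (hr j) _
  refine summable_of_summable_multiIndices (fun α => by have := hpos α; positivity) ?_
  refine (Real.summable_pow_div_factorial (∑ j, r j)).congr fun k => ?_
  have := sum_mul_pow_eq r (fun _ => 1) k
  simp only [mul_one, one_pow, Finset.prod_const_one] at this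
  rw [this, Finset.sum_div]
  refine Finset.sum_congr rfl fun α _ => ?_
  field_simp

theorem norm_charTerm_le {s : (Fin n →₀ ℕ) → ℝ} {C c : ℝ} {α : Fin n →₀ ℕ}
    (h : |s α| ≤ C * c ^ α.degree) (z : Fin n → ℂ) :
    ‖charTerm s z α‖ ≤ C * ((∏ j, (c * ‖z j‖) ^ α j) / ∏ j, ((α j).factorial : ℝ)) := by
  have h1 : ∏ j, (c * ‖z j‖) ^ α j = c ^ α.degree * ∏ j, ‖z j‖ ^ α j := by
    simp only [mul_pow, Finset.prod_mul_distrib, Finsupp.degree_eq_sum,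
      Finset.prod_pow_eq_pow_sum]
  rw [norm_charTerm, h1]
  calc _ ≤ C * c ^ α.degree / (∏ j, ((α j).factorial : ℝ)) * ∏ j, ‖z j‖ ^ α j := by gcongr
    _ = _ := by ring

theorem isEntireSeries_of_abs_le {s : (Fin n →₀ ℕ) → ℝ} {C c : ℝ} (hc : 0 ≤ c)
    (h : ∀ α, |s α| ≤ C * c ^ α.degree) : IsEntireSeries s := fun z =>
  Summable.of_norm_bounded
    ((summable_prod_pow_div_factorial (fun j => c * ‖z j‖) fun j => by positivity).mul_left C)
    fun α => norm_charTerm_le (h α) z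

theorem abs_monom_le_pow {c : ℝ} {x : EuclideanSpace ℝ (Fin n)} (hx : ∀ j, |x j| ≤ c)
    (α : Fin n →₀ ℕ) : |monom α x| ≤ c ^ α.degree := by
  rw [monom, Finset.abs_prod, Finsupp.degree_eq_sum, ← Finset.prod_pow_eq_pow_sum]
  refine Finset.prod_le_prod (fun j _ => abs_nonneg _) fun j _ => ?_
  rw [abs_pow]
  exact pow_le_pow_left₀ (abs_nonneg _) (hx j) _

theorem hasSum_charTerm_monom (x : EuclideanSpace ℝ (Fin n)) (z : Fin n → ℂ) :
    HasSum (charTerm (fun α => monom α x) z) (Complex.exp (Complex.I * ∑ j, x j * z j)) := by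
  have hs : IsEntireSeries fun α => monom α x :=
    isEntireSeries_of_abs_le (C := 1) (norm_nonneg x) fun α => by
      rw [one_mul]
      exact abs_monom_le_pow (fun j => PiLp.norm_apply_le x j) α
  have h1 := (hs z).hasSum
  have h2 := hasSum_multiIndices h1
  have h3 : HasSum (fun k : ℕ => (Complex.I * ∑ j, x j * z j) ^ k / (k.factorial : ℂ))
      (Complex.exp (Complex.I * ∑ j, x j * z j)) := by
    rw [Complex.exp_eq_exp_ℂ]
    exact NormedSpace.expSeries_div_hasSum_exp _
  have h4 : (fun k => ∑ α ∈ multiIndices n k, charTerm (fun α => monom α x) z α) =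
      fun k : ℕ => (Complex.I * ∑ j, x j * z j) ^ k / (k.factorial : ℂ) := by
    ext k
    rw [mul_pow, sum_mul_pow_eq, Finset.mul_sum, Finset.sum_div]
    refine Finset.sum_congr rfl fun α hα => ?_
    have hk : (k.factorial : ℂ) ≠ 0 := Nat.cast_ne_zero.2 k.factorial_ne_zero
    rw [charTerm, monom, mem_multiIndices.1 hα]
    push_cast
    field_simp
  rw [h4] at h2
  rwa [← h2.unique h3]

/-- On the cube `|x^α| ≤ c^|α|`, so the integrals of the norms are summable and the expansion of
`exp(i⟨x, z⟩)` can be integrated termwise. -/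
theorem Represents.hasSum_charTerm {μ : Measure (EuclideanSpace ℝ (Fin n))}
    {s : (Fin n →₀ ℕ) → ℝ} (h : Represents μ s) {c : ℝ} (hc : 0 ≤ c)
    (hμ : ∀ᵐ x ∂μ, ∀ j, x j ∈ Set.Icc (-c) c) (z : Fin n → ℂ) :
    HasSum (charTerm s z) (∫ x, Complex.exp (Complex.I * ∑ j, x j * z j) ∂μ) := by
  have := h.isFiniteMeasure
  have hterm (α : Fin n →₀ ℕ) (x : EuclideanSpace ℝ (Fin n)) :
      charTerm (fun α => monom α x) z α = ((monom α x : ℝ) : ℂ) * charTerm (fun _ => 1) z α := by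
    simp only [charTerm]
    push_cast
    ring
  have hint (α : Fin n →₀ ℕ) : Integrable (fun x => charTerm (fun α => monom α x) z α) μ := by
    simp only [hterm]
    exact (h α).1.ofReal.mul_const _
  have hval (α : Fin n →₀ ℕ) : ∫ x, charTerm (fun α => monom α x) z α ∂μ = charTerm s z α := by
    simp only [hterm]
    rw [integral_mul_const, integral_complex_ofReal, (h α).2, charTerm, charTerm]
    push_cast
    ring
  have hle (α : Fin n →₀ ℕ) : ∫ x, ‖charTerm (fun α => monom α x) z α‖ ∂μ ≤
      (∏ j, (c * ‖z j‖) ^ α j) / (∏ j, ((α j).factorial : ℝ)) * μ.real Set.univ := by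
    calc _ ≤ ∫ _, (∏ j, (c * ‖z j‖) ^ α j) / (∏ j, ((α j).factorial : ℝ)) ∂μ := by
          refine integral_mono_ae (hint α).norm (integrable_const _) ?_
          filter_upwards [hμ] with x hx
          have := norm_charTerm_le (s := fun α => monom α x) (C := 1) (c := c) (α := α)
            (by rw [one_mul]; exact abs_monom_le_pow (fun j => abs_le.2 (hx j)) α) z
          simpa using this
      _ = _ := by rw [integral_const, smul_eq_mul, mul_comm]
  have hsum : Summable fun α => ∫ x, ‖charTerm (fun α => monom α x) z α‖ ∂μ :=
    Summable.of_nonneg_of_le (fun α => integral_nonneg fun x => norm_nonneg _) hle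
      ((summable_prod_pow_div_factorial (fun j => c * ‖z j‖)
        fun j => by positivity).mul_right _)
  have := hasSum_integral_of_summable_integral_norm hint hsum
  simp only [hval, (hasSum_charTerm_monom _ z).tsum_eq] at this
  exact this

theorem Represents.isEntireSeries {μ : Measure (EuclideanSpace ℝ (Fin n))}
    {s : (Fin n →₀ ℕ) → ℝ} (h : Represents μ s) {c : ℝ} (hc : 0 ≤ c)
    (hμ : ∀ᵐ x ∂μ, ∀ j, x j ∈ Set.Icc (-c) c) : IsEntireSeries s :=
  fun z => (h.hasSum_charTerm hc hμ z).summable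

theorem Represents.charFun_eq {μ : Measure (EuclideanSpace ℝ (Fin n))}
    {s : (Fin n →₀ ℕ) → ℝ} (h : Represents μ s) {c : ℝ} (hc : 0 ≤ c)
    (hμ : ∀ᵐ x ∂μ, ∀ j, x j ∈ Set.Icc (-c) c) (z : EuclideanSpace ℝ (Fin n)) :
    charFun μ z = charSeries s z := by
  rw [charSeries, (h.hasSum_charTerm hc hμ _).tsum_eq, charFun_apply]
  refine integral_congr_ae (Eventually.of_forall fun x => ?_)
  simp only [PiLp.inner_apply]
  simp [mul_comm]

/-- A representing measure with compact support is the only representing measure. -/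
theorem Represents.isDeterminate {μ : Measure (EuclideanSpace ℝ (Fin n))}
    {s : (Fin n →₀ ℕ) → ℝ} (h : Represents μ s) {c : ℝ} (hc : 0 ≤ c)
    (hμ : ∀ᵐ x ∂μ, ∀ j, x j ∈ Set.Icc (-c) c) : IsDeterminate s := by
  refine ⟨μ, h, fun ν hν => ?_⟩
  have := h.isFiniteMeasure
  have := hν.isFiniteMeasure
  -- The growth condition mentions only `s`, so it carries the cube from `μ` to an arbitrary
  -- representing measure `ν`.
  have hνc := (hν.momentGrowth_iff hc).1 ((h.momentGrowth_iff hc).2 hμ)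
  refine Measure.ext_of_charFun (funext fun z => ?_)
  rw [hν.charFun_eq hc hνc, h.charFun_eq hc hμ]

/-! ### Gaussian regularization and integrability of a nonnegative transform. -/

theorem cexp_neg_mul_sq_norm {V : Type*} [NormedAddCommGroup V] (b : ℝ) (x : V) :
    Complex.exp (-(b : ℂ) * ‖x‖ ^ 2) = ((Real.exp (-b * ‖x‖ ^ 2) : ℝ) : ℂ) := by
  push_cast
  rfl

section Nonneg

variable {V : Type*} [NormedAddCommGroup V] [InnerProductSpace ℝ V] [FiniteDimensional ℝ V]
  [MeasurableSpace V] [BorelSpace V]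

theorem integrable_cexp_neg_mul_sq_norm {b : ℝ} (hb : 0 < b) :
    Integrable fun x : V => Complex.exp (-(b : ℂ) * ‖x‖ ^ 2) := by
  simpa using GaussianFourier.integrable_cexp_neg_mul_sq_norm_add (V := V) (b := (b : ℂ))
    (by simpa using hb) 0 0

theorem memLp_cexp_neg_mul_sq_norm {b : ℝ} (hb : 0 < b) :
    MemLp (fun x : V => Complex.exp (-(b : ℂ) * ‖x‖ ^ 2)) 2 := by
  rw [memLp_two_iff_integrable_sq_norm (integrable_cexp_neg_mul_sq_norm hb).1]
  refine (integrable_cexp_neg_mul_sq_norm (V := V) (b := 2 * b) (by positivity)).norm.congr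
    (Eventually.of_forall fun x => ?_)
  simp only [cexp_neg_mul_sq_norm, Complex.norm_real, Real.norm_eq_abs, Real.abs_exp]
  rw [← Real.exp_nat_mul]
  congr 1
  push_cast
  ring

/-- An approximate identity at 0. The fixed Gaussian factor has value 1 there and makes the merely
square integrable `F` integrable. -/
theorem tendsto_integral_gaussian_peak {F : V → ℂ} (hF : MemLp F 2) (hF0 : ContinuousAt F 0) :
    Tendsto (fun c : ℝ => ∫ x, (c ^ Module.finrank ℝ V * Real.exp (-Real.pi * ‖c • x‖ ^ 2)) •
      (F x * Complex.exp (-(Real.pi : ℂ) * ‖x‖ ^ 2))) atTop (𝓝 (F 0)) := by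
  have hint : Integrable fun x => F x * Complex.exp (-(Real.pi : ℂ) * ‖x‖ ^ 2) :=
    hF.integrable_mul (memLp_cexp_neg_mul_sq_norm Real.pi_pos)
  have hone : ∫ x : V, Real.exp (-Real.pi * ‖x‖ ^ 2) = 1 := by
    rw [GaussianFourier.integral_rexp_neg_mul_sq_norm Real.pi_pos, div_self Real.pi_ne_zero,
      Real.one_rpow]
  have hdecay : Tendsto (fun x : V => ‖x‖ ^ Module.finrank ℝ V * Real.exp (-Real.pi * ‖x‖ ^ 2))
      (Bornology.cobounded V) (𝓝 0) := by
    have h1 := (Real.tendsto_pow_mul_exp_neg_atTop_nhds_zero (Module.finrank ℝ V)).comp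
      (tendsto_norm_cobounded_atTop (E := V))
    refine squeeze_zero' (Eventually.of_forall fun x => by positivity) ?_ h1
    filter_upwards [(tendsto_norm_cobounded_atTop (E := V)).eventually_ge_atTop 1] with x hx
    refine mul_le_mul_of_nonneg_left (Real.exp_le_exp.2 ?_) (by positivity)
    nlinarith [Real.pi_gt_three]
  have hc : ContinuousAt (fun x => F x * Complex.exp (-(Real.pi : ℂ) * ‖x‖ ^ 2)) 0 :=
    hF0.mul (by fun_prop)
  have := tendsto_integral_comp_smul_smul_of_integrable (μ := (volume : Measure V))
    (φ := fun x => Real.exp (-Real.pi * ‖x‖ ^ 2)) (fun x => (Real.exp_pos _).le) hone hdecay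
    hint hc
  simpa using this

/-- The width `b = π/(1 + c²)` is chosen so that the transformed Gaussian `exp(-π²‖x‖²/b)` splits
into the peak `exp(-π‖cx‖²)` and the fixed factor `exp(-π‖x‖²)`. The remaining constant is `((1 +
c²)^(1/2)/c)^d ≤ 2^d`, because `c ≥ 1`. -/
theorem norm_integral_fourierL2_mul_gaussian_le {F : V → ℂ} (hF : MemLp F 2) {c : ℝ}
    (hc : 1 ≤ c) :
    ‖∫ x, (𝓕 (hF.toLp F) : Lp ℂ 2 (volume : Measure V)) x *
        Complex.exp (-((Real.pi / (1 + c ^ 2) : ℝ) : ℂ) * ‖x‖ ^ 2)‖ ≤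
      2 ^ Module.finrank ℝ V *
      ‖∫ x, (c ^ Module.finrank ℝ V * Real.exp (-Real.pi * ‖c • x‖ ^ 2)) •
        (F x * Complex.exp (-(Real.pi : ℂ) * ‖x‖ ^ 2))‖ := by
  set d := Module.finrank ℝ V
  set b : ℝ := Real.pi / (1 + c ^ 2)
  have hc0 : 0 < c := one_pos.trans_le hc
  have hb : 0 < b := by positivity
  set φ : V → ℂ := fun x => Complex.exp (-(b : ℂ) * ‖x‖ ^ 2)
  have hφ1 : Integrable φ := integrable_cexp_neg_mul_sq_norm hb
  have hφ2 : MemLp φ 2 := memLp_cexp_neg_mul_sq_norm hb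
  have h1 : ∫ x, (𝓕 (hF.toLp F) : Lp ℂ 2 (volume : Measure V)) x * φ x =
      ∫ x, F x * 𝓕 φ x := by
    have := integral_fourierL2_mul (hF.toLp F) (hφ2.toLp φ)
    refine (integral_congr_ae ?_).trans (this.trans (integral_congr_ae ?_))
    · filter_upwards [hφ2.coeFn_toLp] with x hx
      rw [hx]
    · filter_upwards [hF.coeFn_toLp, fourier_toLp_ae_eq hφ1 hφ2] with x hx hx'
      rw [hx, hx']
  have hπb : Real.pi / b = 1 + c ^ 2 := by
    simp only [b]
    field_simp
  have h2 : ∫ x, F x * 𝓕 φ x = ((Real.pi / b : ℂ) ^ (d / 2 : ℂ) * ((c ^ d : ℝ) : ℂ)⁻¹) *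
      ∫ x, (c ^ d * Real.exp (-Real.pi * ‖c • x‖ ^ 2)) •
        (F x * Complex.exp (-(Real.pi : ℂ) * ‖x‖ ^ 2)) := by
    rw [← integral_const_mul]
    refine integral_congr_ae (Eventually.of_forall fun x => ?_)
    have hcd : ((c ^ d : ℝ) : ℂ) ≠ 0 := by
      rw [Complex.ofReal_ne_zero]
      positivity
    have hex : Complex.exp (-Real.pi ^ 2 * ‖x‖ ^ 2 / b) =
        ((Real.exp (-Real.pi * ‖c • x‖ ^ 2) : ℝ) : ℂ) *
          Complex.exp (-(Real.pi : ℂ) * ‖x‖ ^ 2) := by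
      rw [Complex.ofReal_exp, ← Complex.exp_add]
      congr 1
      have : -Real.pi ^ 2 * ‖x‖ ^ 2 / b = -Real.pi * ‖c • x‖ ^ 2 + -Real.pi * ‖x‖ ^ 2 := by
        rw [show -Real.pi ^ 2 * ‖x‖ ^ 2 / b = -Real.pi * ‖x‖ ^ 2 * (Real.pi / b) by ring, hπb,
          norm_smul, mul_pow, Real.norm_eq_abs, sq_abs]
        ring
      exact_mod_cast this
    have hfou := fourier_gaussian_innerProductSpace (V := V) (b := (b : ℂ))
      (by simpa using hb) x
    simp only [φ, hfou, hex, Complex.real_smul, Complex.ofReal_mul]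
    field_simp
    rfl
  have hbound : ‖(Real.pi / b : ℂ) ^ (d / 2 : ℂ) * ((c ^ d : ℝ) : ℂ)⁻¹‖ ≤ 2 ^ d := by
    rw [norm_mul, norm_inv, Complex.norm_real, Real.norm_of_nonneg (by positivity),
      ← Complex.ofReal_div, hπb, Complex.norm_cpow_eq_rpow_re_of_pos (by positivity)]
    have hre : (d / 2 : ℂ).re = (d : ℝ) / 2 := by
      rw [show (d / 2 : ℂ) = (((d : ℝ) / 2 : ℝ) : ℂ) by push_cast; rfl, Complex.ofReal_re]
    rw [hre, ← div_eq_mul_inv, div_le_iff₀ (by positivity), ← mul_pow]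
    calc (1 + c ^ 2) ^ ((d : ℝ) / 2) ≤ ((2 * c) ^ 2) ^ ((d : ℝ) / 2) := by
          refine Real.rpow_le_rpow (by positivity) ?_ (by positivity)
          nlinarith
      _ = (2 * c) ^ d := by
          rw [← Real.rpow_natCast (2 * c) 2, ← Real.rpow_mul (by positivity),
            ← Real.rpow_natCast (2 * c) d]
          congr 1
          push_cast
          ring
  rw [h1, h2, norm_mul]
  exact mul_le_mul_of_nonneg_right hbound (norm_nonneg _)

/-- A square integrable function that is continuous at the origin and has a nonnegative Fourier
transform has an integrable Fourier transform. -/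
theorem integrable_of_fourierL2_nonneg {F g : V → ℂ} (hF : MemLp F 2) (hF0 : ContinuousAt F 0)
    (hg : (𝓕 (hF.toLp F) : Lp ℂ 2 (volume : Measure V)) =ᵐ[volume] g)
    (hnn : ∀ᵐ x, 0 ≤ (g x).re ∧ (g x).im = 0) : Integrable g := by
  have hg2 : MemLp g 2 := (memLp_congr_ae hg).1 (Lp.memLp _)
  have hre : AEStronglyMeasurable (fun x => (g x).re) :=
    Complex.continuous_re.comp_aestronglyMeasurable hg2.1
  have hgre : g =ᵐ[volume] fun x => ((g x).re : ℂ) := by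
    filter_upwards [hnn] with x hx
    exact Complex.ext rfl hx.2
  suffices h : Integrable fun x => (g x).re from h.ofReal.congr hgre.symm
  set C : ℝ := 2 ^ Module.finrank ℝ V * (‖F 0‖ + 1)
  set b : ℕ → ℝ := fun k => Real.pi / (1 + (k : ℝ) ^ 2)
  have hb : ∀ k, 0 < b k := fun k => by positivity
  have hb0 : Tendsto b atTop (𝓝 0) := by
    refine Tendsto.const_div_atTop (tendsto_atTop_add_const_left _ _ ?_) _
    exact (tendsto_pow_atTop two_ne_zero).comp tendsto_natCast_atTop_atTop
  have hle : ∀ᶠ k in atTop, ∫⁻ x, ENNReal.ofReal ((g x).re * Real.exp (-b k * ‖x‖ ^ 2)) ≤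
      ENNReal.ofReal C := by
    have h1 := ((tendsto_integral_gaussian_peak hF hF0).comp
      (tendsto_natCast_atTop_atTop (R := ℝ))).norm.eventually_lt_const (lt_add_one ‖F 0‖)
    filter_upwards [h1, eventually_ge_atTop 1] with k hk hk1
    have h2 := norm_integral_fourierL2_mul_gaussian_le hF (c := (k : ℝ)) (by exact_mod_cast hk1)
    have h3 : ∫ x, (𝓕 (hF.toLp F) : Lp ℂ 2 (volume : Measure V)) x *
        Complex.exp (-((Real.pi / (1 + (k : ℝ) ^ 2) : ℝ) : ℂ) * ‖x‖ ^ 2) =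
        ((∫ x, (g x).re * Real.exp (-b k * ‖x‖ ^ 2) : ℝ) : ℂ) := by
      rw [← integral_complex_ofReal]
      refine integral_congr_ae ?_
      filter_upwards [hg, hgre] with x hx hx'
      rw [hx, hx', cexp_neg_mul_sq_norm, Complex.ofReal_mul, Complex.ofReal_re]
    rw [h3, Complex.norm_real] at h2
    rw [← ofReal_integral_eq_lintegral_ofReal]
    · refine ENNReal.ofReal_le_ofReal ((le_abs_self _).trans (h2.trans ?_))
      exact mul_le_mul_of_nonneg_left hk.le (by positivity)
    · have := (hg2.integrable_mul (memLp_cexp_neg_mul_sq_norm (hb k))).re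
      refine this.congr (Eventually.of_forall fun x => ?_)
      change (g x * Complex.exp (-(b k : ℂ) * ‖x‖ ^ 2)).re = _
      rw [cexp_neg_mul_sq_norm, Complex.re_mul_ofReal]
    · filter_upwards [hnn] with x hx
      exact mul_nonneg hx.1 (Real.exp_pos _).le
  refine ⟨hre, ?_⟩
  rw [hasFiniteIntegral_iff_ofReal (hnn.mono fun x hx => hx.1)]
  have hpt (x : V) : Tendsto (fun k => ENNReal.ofReal ((g x).re * Real.exp (-b k * ‖x‖ ^ 2)))
      atTop (𝓝 (ENNReal.ofReal (g x).re)) := by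
    refine ENNReal.tendsto_ofReal ?_
    have h1 : Tendsto (fun k => -b k * ‖x‖ ^ 2) atTop (𝓝 0) := by
      simpa using hb0.neg.mul_const (‖x‖ ^ 2)
    simpa using ((Real.continuous_exp.tendsto 0).comp h1).const_mul (g x).re
  calc ∫⁻ x, ENNReal.ofReal (g x).re
      = ∫⁻ x, liminf (fun k => ENNReal.ofReal ((g x).re * Real.exp (-b k * ‖x‖ ^ 2))) atTop :=
        lintegral_congr fun x => (hpt x).liminf_eq.symm
    _ ≤ liminf (fun k => ∫⁻ x, ENNReal.ofReal ((g x).re * Real.exp (-b k * ‖x‖ ^ 2))) atTop := by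
        refine lintegral_liminf_le' fun k => ?_
        have : Measurable fun x : V => Real.exp (-b k * ‖x‖ ^ 2) := by fun_prop
        exact (hre.aemeasurable.mul this.aemeasurable).ennreal_ofReal
    _ ≤ ENNReal.ofReal C := liminf_le_of_frequently_le' hle.frequently
    _ < ⊤ := ENNReal.ofReal_lt_top

theorem continuous_fourierInv_of_integrable {u : V → ℂ} (hu : Integrable u) :
    Continuous (𝓕⁻ u) := by
  rw [Real.fourierInv_eq_fourier_comp_neg]
  exact continuous_fourier_of_integrable hu.comp_neg

/-- Pointwise Fourier inversion for a continuous square integrable function whose Fourier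
transform is integrable. -/
theorem eq_fourierInv_of_fourierL2_ae_eq {F g : V → ℂ} (hF : MemLp F 2) (hFc : Continuous F)
    (hg : (𝓕 (hF.toLp F) : Lp ℂ 2 (volume : Measure V)) =ᵐ[volume] g)
    (hg1 : Integrable g) : F = 𝓕⁻ g := by
  have hg2 : MemLp g 2 := (memLp_congr_ae hg).1 (Lp.memLp _)
  have h1 : hg2.toLp g = 𝓕 (hF.toLp F) := Lp.ext (hg2.coeFn_toLp.trans hg.symm)
  have h2 : (𝓕⁻ (hg2.toLp g) : Lp ℂ 2 (volume : Measure V)) = hF.toLp F := by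
    rw [h1, FourierPair.fourierInv_fourier_eq]
  have h3 := fourierInv_toLp_ae_eq hg1 hg2
  rw [h2] at h3
  exact (hFc.ae_eq_iff_eq volume (continuous_fourierInv_of_integrable hg1)).1
    (hF.coeFn_toLp.symm.trans h3)

end Nonneg

/-! ### The measure with density g and its characteristic function. -/

theorem NonnegAE.ae_eq_ofReal_re {g : EuclideanSpace ℝ (Fin n) → ℂ} (hnn : NonnegAE g) :
    ∀ᵐ x, g x = ((g x).re : ℂ) := by
  filter_upwards [hnn] with x hx
  exact Complex.ext rfl hx.2

theorem integral_withDensity_ofReal_re {g : EuclideanSpace ℝ (Fin n) → ℂ}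
    (hg : AEStronglyMeasurable g) (hnn : NonnegAE g) (φ : EuclideanSpace ℝ (Fin n) → ℂ) :
    ∫ x, φ x ∂(volume.withDensity fun x => ENNReal.ofReal (g x).re) = ∫ x, φ x * g x := by
  have hre : AEMeasurable fun x => (g x).re :=
    (Complex.continuous_re.comp_aestronglyMeasurable hg).aemeasurable
  have := integral_withDensity_eq_integral_smul₀ (f := fun x => (g x).re.toNNReal)
    (μ := volume) hre.real_toNNReal φ
  refine this.trans (integral_congr_ae ?_)
  filter_upwards [hnn, hnn.ae_eq_ofReal_re] with x hx hx'
  rw [NNReal.smul_def, Real.coe_toNNReal _ hx.1, Complex.real_smul, ← hx', mul_comm]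

theorem charFun_withDensity {g : EuclideanSpace ℝ (Fin n) → ℂ} (hg : AEStronglyMeasurable g)
    (hnn : NonnegAE g) (w : EuclideanSpace ℝ (Fin n)) :
    charFun (volume.withDensity fun x => ENNReal.ofReal (g x).re) ((2 * Real.pi) • w) =
      𝓕⁻ g w := by
  rw [charFun_apply, integral_withDensity_ofReal_re hg hnn, Real.fourierInv_eq']
  refine integral_congr_ae (Eventually.of_forall fun x => ?_)
  simp only [inner_smul_right, smul_eq_mul]

theorem ae_withDensity_iff_suppInCube {g : EuclideanSpace ℝ (Fin n) → ℂ}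
    (hg : AEStronglyMeasurable g) (hnn : NonnegAE g) (c : ℝ) :
    (∀ᵐ x ∂(volume.withDensity fun x => ENNReal.ofReal (g x).re),
      ∀ j, x j ∈ Set.Icc (-c) c) ↔ SuppInCube c g := by
  have hre : AEMeasurable fun x => (g x).re :=
    (Complex.continuous_re.comp_aestronglyMeasurable hg).aemeasurable
  rw [ae_withDensity_iff' hre.ennreal_ofReal, SuppInCube]
  refine eventually_congr ?_
  filter_upwards [hnn, hnn.ae_eq_ofReal_re] with x hx hx'
  have h0 : ENNReal.ofReal (g x).re ≠ 0 ↔ g x ≠ 0 := by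
    rw [Ne, ENNReal.ofReal_eq_zero, not_le, hx', Complex.ofReal_re, Complex.ofReal_ne_zero]
    exact hx.1.lt_iff_ne'
  rw [h0]
  exact not_imp_comm

/-- An entire series with a nonnegative square integrable inverse Fourier transform is the series
of the moments of that transform. -/
theorem represents_density {s : (Fin n →₀ ℕ) → ℝ} (hs : IsEntireSeries s)
    (hf : MemLp (charSeries s) 2 volume) (hnn : NonnegAE (density (charSeries s) hf)) :
    Integrable (density (charSeries s) hf) ∧
    Represents (volume.withDensity fun x =>
      ENNReal.ofReal (density (charSeries s) hf x).re) s := by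
  have hf' := memLp_comp_smul hf Real.two_pi_pos.ne'
  have hcont : Continuous fun x => charSeries s ((2 * Real.pi) • x) :=
    (continuous_charSeries hs).comp (continuous_const_smul _)
  have hd := (density_ae_eq hf hf').symm
  have hint := integrable_of_fourierL2_nonneg hf' hcont.continuousAt hd hnn
  refine ⟨hint, ?_⟩
  have := isFiniteMeasure_withDensity_ofReal hint.re.hasFiniteIntegral
  refine represents_of_charFun_eq hs fun z => ?_
  have h1 := congrFun (eq_fourierInv_of_fourierL2_ae_eq hf' hcont hd hint) ((2 * Real.pi)⁻¹ • z)
  rw [← charFun_withDensity hint.1 hnn, smul_inv_smul₀ Real.two_pi_pos.ne'] at h1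
  exact h1.symm

/-! ### Weak derivatives -/

/-- The existential form records that derivatives stay Schwartz, so that the Fourier multiplier can
be accumulated inductively, first in one direction and then over all of them. -/
theorem iterate_lineDeriv_schwartz (Φ : SchwartzMap (EuclideanSpace ℝ (Fin n)) ℂ) (j : Fin n)
    (k : ℕ) : ∃ S : SchwartzMap (EuclideanSpace ℝ (Fin n)) ℂ,
      (fun η x => lineDeriv ℝ η x (EuclideanSpace.single j 1))^[k]
        (Φ : EuclideanSpace ℝ (Fin n) → ℂ) = S ∧
      ∀ w, 𝓕 (S : EuclideanSpace ℝ (Fin n) → ℂ) w =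
        (Complex.I * ((2 * Real.pi) • w : EuclideanSpace ℝ (Fin n)) j) ^ k *
          𝓕 (Φ : EuclideanSpace ℝ (Fin n) → ℂ) w := by
  induction k with
  | zero => exact ⟨Φ, rfl, fun w => by simp⟩
  | succ k ih =>
    obtain ⟨S, hS, hF⟩ := ih
    refine ⟨LineDeriv.lineDerivOp (EuclideanSpace.single j (1 : ℝ)) S, ?_, fun w => ?_⟩
    · rw [Function.iterate_succ_apply', hS]
      ext x
      rw [SchwartzMap.lineDerivOp_apply]
    · have h := congrArg (fun T : SchwartzMap (EuclideanSpace ℝ (Fin n)) ℂ => T w)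
        (SchwartzMap.fourier_lineDerivOp_eq S (EuclideanSpace.single j (1 : ℝ)))
      have ht : (fun x : EuclideanSpace ℝ (Fin n) =>
          inner ℝ x (EuclideanSpace.single j (1 : ℝ))).HasTemperateGrowth :=
        ((innerSL ℝ).flip _).hasTemperateGrowth
      simp only [smul_apply, SchwartzMap.smulLeftCLM_apply_apply ht,
        SchwartzMap.fourier_coe, hF] at h
      rw [h]
      simp [EuclideanSpace.inner_single_right]
      ring

theorem partialDeriv_schwartz (β : Fin n →₀ ℕ)
    (Φ : SchwartzMap (EuclideanSpace ℝ (Fin n)) ℂ) :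
    ∃ S : SchwartzMap (EuclideanSpace ℝ (Fin n)) ℂ, partialDeriv β Φ = S ∧
      ∀ w, 𝓕 (S : EuclideanSpace ℝ (Fin n) → ℂ) w =
        Complex.I ^ β.degree * monom β ((2 * Real.pi) • w) *
          𝓕 (Φ : EuclideanSpace ℝ (Fin n) → ℂ) w := by
  have key : ∀ l : List (Fin n), ∃ S : SchwartzMap (EuclideanSpace ℝ (Fin n)) ℂ,
      l.foldr (fun j ψ => (fun η x => lineDeriv ℝ η x (EuclideanSpace.single j 1))^[β j] ψ)
        (Φ : EuclideanSpace ℝ (Fin n) → ℂ) = S ∧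
      ∀ w, 𝓕 (S : EuclideanSpace ℝ (Fin n) → ℂ) w =
        (l.map fun j => (Complex.I * ((2 * Real.pi) • w : EuclideanSpace ℝ (Fin n)) j) ^ β j).prod
          * 𝓕 (Φ : EuclideanSpace ℝ (Fin n) → ℂ) w := by
    intro l
    induction l with
    | nil => exact ⟨Φ, rfl, fun w => by simp⟩
    | cons j l ih =>
      obtain ⟨S, hS, hF⟩ := ih
      obtain ⟨S', hS', hF'⟩ := iterate_lineDeriv_schwartz S j (β j)
      refine ⟨S', by rw [List.foldr_cons, hS, hS'], fun w => ?_⟩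
      rw [hF', hF, List.map_cons, List.prod_cons, mul_assoc]
  obtain ⟨S, hS, hF⟩ := key (List.finRange n)
  refine ⟨S, hS, fun w => ?_⟩
  rw [hF, ← List.ofFn_eq_map, List.prod_ofFn, monom]
  simp only [mul_pow, Finset.prod_mul_distrib, Finset.prod_pow_eq_pow_sum,
    ← Finsupp.degree_eq_sum]
  push_cast
  rfl

theorem weakDerivMemL2_density {f : EuclideanSpace ℝ (Fin n) → ℂ} (hf : MemLp f 2 volume)
    {β : Fin n →₀ ℕ} (hβ : MemLp (fun x => (monom β x : ℂ) * f x) 2 volume) :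
    WeakDerivMemL2 β (density f hf) := by
  have hf' := memLp_comp_smul hf Real.two_pi_pos.ne'
  have hβ' := memLp_comp_smul hβ Real.two_pi_pos.ne'
  have hd := density_ae_eq hf hf'
  -- Transforming `∂^β φ` produces `i^|β| (2πw)^β`, and the monomial is absorbed into f. The extra
  -- `(-1)^|β|` cancels the sign in the definition of a weak derivative.
  refine ⟨fun x => (-1) ^ β.degree * (Complex.I ^ β.degree * (𝓕 (hβ'.toLp _) :
    Lp ℂ 2 (volume : Measure (EuclideanSpace ℝ (Fin n)))) x),
    ((Lp.memLp _).const_mul _).const_mul _, fun φ hφ hc => ?_⟩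
  obtain ⟨S, hS, hF⟩ := partialDeriv_schwartz β (hc.toSchwartzMap hφ)
  have hS' : partialDeriv β φ = S := hS
  have h1 : ∫ x, density f hf x * partialDeriv β φ x =
      ∫ x, (𝓕 (hf'.toLp _) : Lp ℂ 2 (volume : Measure (EuclideanSpace ℝ (Fin n)))) x * S x := by
    refine integral_congr_ae ?_
    filter_upwards [hd] with x hx
    rw [hx, hS']
  have h2 := integral_fourierL2_mul_schwartz (hβ'.toLp _) (hc.toSchwartzMap hφ)
  have h3 : ∫ x, (-1) ^ β.degree * (Complex.I ^ β.degree * (𝓕 (hβ'.toLp _) :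
      Lp ℂ 2 (volume : Measure (EuclideanSpace ℝ (Fin n)))) x) * φ x =
      (-1) ^ β.degree * (Complex.I ^ β.degree * ∫ x, (𝓕 (hβ'.toLp _) :
      Lp ℂ 2 (volume : Measure (EuclideanSpace ℝ (Fin n)))) x * φ x) := by
    rw [← integral_const_mul, ← integral_const_mul]
    simp only [mul_assoc]
  have h2' : ∫ x, (𝓕 (hβ'.toLp _) :
      Lp ℂ 2 (volume : Measure (EuclideanSpace ℝ (Fin n)))) x * φ x = _ := h2
  rw [h1, integral_fourierL2_mul_schwartz, h3, ← mul_assoc, ← mul_pow, neg_one_mul, neg_neg,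
    one_pow, one_mul, h2', ← integral_const_mul]
  refine integral_congr_ae ?_
  filter_upwards [hf'.coeFn_toLp, hβ'.coeFn_toLp] with x hx hx'
  rw [hx, hx', hF]
  ring

/-! ### Locality, characters, and weak derivatives of compactly supported functions. -/

theorem eqOn_partialDeriv {φ ψ : EuclideanSpace ℝ (Fin n) → ℂ}
    {U : Set (EuclideanSpace ℝ (Fin n))} (h : Set.EqOn φ ψ U) (hU : IsOpen U)
    (β : Fin n →₀ ℕ) : Set.EqOn (partialDeriv β φ) (partialDeriv β ψ) U := by
  have h1 (j : Fin n) (k : ℕ) {φ ψ : EuclideanSpace ℝ (Fin n) → ℂ} (h : Set.EqOn φ ψ U) :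
      Set.EqOn ((fun η x => lineDeriv ℝ η x (EuclideanSpace.single j 1))^[k] φ)
        ((fun η x => lineDeriv ℝ η x (EuclideanSpace.single j 1))^[k] ψ) U := by
    induction k with
    | zero => exact h
    | succ k ih =>
      rw [Function.iterate_succ_apply', Function.iterate_succ_apply']
      exact fun x hx => (ih.eventuallyEq_of_mem (hU.mem_nhds hx)).lineDeriv_eq
  unfold partialDeriv
  induction List.finRange n with
  | nil => exact h
  | cons j l ih => exact h1 j _ ih

theorem hasLineDerivAt_character (a : ℂ) (w x : EuclideanSpace ℝ (Fin n)) (j : Fin n) :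
    HasLineDerivAt ℝ (fun x => a * Complex.exp ((2 * Real.pi * inner ℝ x w : ℝ) * Complex.I))
      (a * (Complex.I * ((2 * Real.pi) • w : EuclideanSpace ℝ (Fin n)) j) *
        Complex.exp ((2 * Real.pi * inner ℝ x w : ℝ) * Complex.I)) x
      (EuclideanSpace.single j 1) := by
  have h1 : HasDerivAt (fun t : ℝ => 2 * Real.pi *
      inner ℝ (x + t • EuclideanSpace.single j (1 : ℝ)) w) (2 * Real.pi * w j) 0 := by
    have : (fun t : ℝ => 2 * Real.pi * inner ℝ (x + t • EuclideanSpace.single j (1 : ℝ)) w) =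
        fun t : ℝ => 2 * Real.pi * inner ℝ x w + t * (2 * Real.pi * w j) := by
      ext t
      rw [inner_add_left, inner_smul_left, EuclideanSpace.inner_single_left]
      simp
      ring
    rw [this]
    exact (hasDerivAt_mul_const _).const_add _
  have h2 := ((h1.ofReal_comp.mul_const Complex.I).cexp).const_mul a
  refine h2.congr_deriv ?_
  simp
  ring

theorem partialDeriv_character (β : Fin n →₀ ℕ) (a : ℂ) (w : EuclideanSpace ℝ (Fin n)) :
    partialDeriv β
      (fun x => a * Complex.exp ((2 * Real.pi * inner ℝ x w : ℝ) * Complex.I)) =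
      fun x => a * (Complex.I ^ β.degree * monom β ((2 * Real.pi) • w)) *
        Complex.exp ((2 * Real.pi * inner ℝ x w : ℝ) * Complex.I) := by
  have h1 (j : Fin n) (k : ℕ) (a : ℂ) :
      (fun η x => lineDeriv ℝ η x (EuclideanSpace.single j 1))^[k]
        (fun x => a * Complex.exp ((2 * Real.pi * inner ℝ x w : ℝ) * Complex.I)) =
      fun x => a * (Complex.I * ((2 * Real.pi) • w : EuclideanSpace ℝ (Fin n)) j) ^ k *
        Complex.exp ((2 * Real.pi * inner ℝ x w : ℝ) * Complex.I) := by
    induction k with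
    | zero => simp
    | succ k ih =>
      rw [Function.iterate_succ_apply', ih]
      ext x
      rw [(hasLineDerivAt_character _ w x j).lineDeriv, mul_assoc a, ← pow_succ]
  have h2 (l : List (Fin n)) :
      l.foldr (fun j ψ => (fun η x => lineDeriv ℝ η x (EuclideanSpace.single j 1))^[β j] ψ)
        (fun x => a * Complex.exp ((2 * Real.pi * inner ℝ x w : ℝ) * Complex.I)) =
      fun x => a *
        (l.map fun j => (Complex.I * ((2 * Real.pi) • w : EuclideanSpace ℝ (Fin n)) j) ^ β j).prod
        * Complex.exp ((2 * Real.pi * inner ℝ x w : ℝ) * Complex.I) := by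
    induction l with
    | nil => simp
    | cons j l ih =>
      rw [List.foldr_cons, ih, h1, List.map_cons, List.prod_cons]
      ext x
      ring
  rw [partialDeriv, h2, ← List.ofFn_eq_map, List.prod_ofFn, monom]
  simp only [mul_pow, Finset.prod_mul_distrib, Finset.prod_pow_eq_pow_sum,
    ← Finsupp.degree_eq_sum]
  push_cast
  rfl

/-- The cube `[-c, c]ⁿ`. -/
def cube (n : ℕ) (c : ℝ) : Set (EuclideanSpace ℝ (Fin n)) := {x | ∀ j, x j ∈ Set.Icc (-c) c}

theorem isClosed_cube (c : ℝ) : IsClosed (cube n c) := by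
  simp only [cube, Set.ofPred_forall]
  exact isClosed_iInter fun j => isClosed_Icc.preimage (by fun_prop)

theorem norm_le_of_mem_cube {c : ℝ} {x : EuclideanSpace ℝ (Fin n)} (hx : x ∈ cube n c) :
    ‖x‖ ≤ √(n * c ^ 2) := by
  rw [EuclideanSpace.norm_eq]
  refine Real.sqrt_le_sqrt ?_
  calc ∑ j, ‖x j‖ ^ 2 ≤ ∑ _j : Fin n, c ^ 2 := by
        refine Finset.sum_le_sum fun j _ => ?_
        exact pow_le_pow_left₀ (norm_nonneg _) (abs_le.2 (hx j)) 2
    _ = n * c ^ 2 := by simp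

theorem SuppInCube.integrable {c : ℝ} {g : EuclideanSpace ℝ (Fin n) → ℂ} (h : SuppInCube c g)
    (hg : MemLp g 2 volume) : Integrable g := by
  have hsub : cube n c ⊆ Metric.closedBall 0 (√(n * c ^ 2)) := fun x hx => by
    simpa using norm_le_of_mem_cube hx
  have hfin : IsFiniteMeasure (volume.restrict (cube n c)) :=
    ⟨by
      rw [Measure.restrict_apply_univ]
      exact (measure_mono hsub).trans_lt measure_closedBall_lt_top⟩
  have h1 : IntegrableOn g (cube n c) := (hg.restrict (cube n c)).integrable one_le_two
  exact h1.integrable_of_ae_notMem_eq_zero h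

theorem integral_mul_eq_of_eqOn {c : ℝ} {g φ ψ : EuclideanSpace ℝ (Fin n) → ℂ}
    (hg : SuppInCube c g) (h : Set.EqOn φ ψ (cube n c)) :
    ∫ x, g x * φ x = ∫ x, g x * ψ x := by
  refine integral_congr_ae ?_
  filter_upwards [hg] with x hx
  by_cases hxc : x ∈ cube n c
  · rw [h hxc]
  · rw [hx hxc, zero_mul, zero_mul]

/-- Weak derivatives do not enlarge the support. -/
theorem suppInCube_of_weakDeriv {c : ℝ} {g h : EuclideanSpace ℝ (Fin n) → ℂ}
    (hg : SuppInCube c g) (hh : MemLp h 2 volume) {β : Fin n →₀ ℕ}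
    (hweak : ∀ φ : EuclideanSpace ℝ (Fin n) → ℂ, ContDiff ℝ ∞ φ → HasCompactSupport φ →
      ∫ x, g x * partialDeriv β φ x = (-1) ^ β.degree * ∫ x, h x * φ x) :
    SuppInCube c h := by
  refine (isClosed_cube (n := n) c).isOpen_compl.ae_eq_zero_of_integral_contDiff_smul_eq_zero
    ((hh.locallyIntegrable one_le_two).locallyIntegrableOn _) fun χ hχ hc hsupp => ?_
  have h1 := hweak (Complex.ofRealCLM ∘ χ) (by fun_prop) (hc.comp_left rfl)
  have h2 : ∫ x, g x * partialDeriv β (Complex.ofRealCLM ∘ χ) x = 0 := by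
    -- Zero is written as a character with coefficient 0, so that `partialDeriv_character` also
    -- shows that its derivatives vanish.
    have h3 : Set.EqOn (Complex.ofRealCLM ∘ χ) (fun x => 0 * Complex.exp
        ((2 * Real.pi * inner ℝ x (0 : EuclideanSpace ℝ (Fin n)) : ℝ) * Complex.I))
        (tsupport χ)ᶜ := fun x hx => by
      simp [image_eq_zero_of_notMem_tsupport hx]
    have h4 := eqOn_partialDeriv h3 (isClosed_tsupport χ).isOpen_compl β
    rw [partialDeriv_character] at h4
    have h5 : Set.EqOn (partialDeriv β (Complex.ofRealCLM ∘ χ)) (fun _ => 0) (cube n c) :=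
      fun x hx => by
        have := h4 (show x ∈ (tsupport χ)ᶜ from fun hx' => hsupp hx' hx)
        simpa using this
    rw [integral_mul_eq_of_eqOn hg h5]
    simp
  rw [h2, eq_comm, mul_eq_zero, or_iff_right (pow_ne_zero _ (by norm_num))] at h1
  rw [← h1]
  refine integral_congr_ae (Eventually.of_forall fun x => ?_)
  simp [mul_comm]

/-- The character at `w` is an eigenfunction of `∂^β`. It is not compactly supported, but g and h
live on the cube, so it may be cut off outside. -/
theorem fourierInv_weakDeriv {c : ℝ} {g h : EuclideanSpace ℝ (Fin n) → ℂ}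
    (hg : SuppInCube c g) (hh : MemLp h 2 volume) {β : Fin n →₀ ℕ}
    (hweak : ∀ φ : EuclideanSpace ℝ (Fin n) → ℂ, ContDiff ℝ ∞ φ → HasCompactSupport φ →
      ∫ x, g x * partialDeriv β φ x = (-1) ^ β.degree * ∫ x, h x * φ x)
    (w : EuclideanSpace ℝ (Fin n)) :
    𝓕⁻ h w = (-Complex.I) ^ β.degree * (monom β ((2 * Real.pi) • w) * 𝓕⁻ g w) := by
  have hhc := suppInCube_of_weakDeriv hg hh hweak
  -- The margin 1 puts the cube inside an open ball on which `χ = 1`, so the cutoff changes no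
  -- derivative there.
  let χ : ContDiffBump (0 : EuclideanSpace ℝ (Fin n)) :=
    ⟨√(n * c ^ 2) + 1, √(n * c ^ 2) + 2, by positivity, by linarith⟩
  set e : EuclideanSpace ℝ (Fin n) → ℂ :=
    fun x => 1 * Complex.exp ((2 * Real.pi * inner ℝ x w : ℝ) * Complex.I)
  have he : ContDiff ℝ ∞ e := by
    have : ContDiff ℝ ∞ fun x : EuclideanSpace ℝ (Fin n) => 2 * Real.pi * inner ℝ x w :=
      contDiff_const.mul (contDiff_id.inner ℝ contDiff_const)
    exact contDiff_const.mul (((Complex.ofRealCLM.contDiff.comp this).mul contDiff_const).cexp)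
  have hball : cube n c ⊆ Metric.ball 0 (√(n * c ^ 2) + 1) := fun x hx => by
    simpa using (norm_le_of_mem_cube hx).trans_lt (lt_add_one _)
  have hEq : Set.EqOn (fun x => (χ x : ℂ) * e x) e (Metric.ball 0 (√(n * c ^ 2) + 1)) :=
    fun x hx => by
      change (χ x : ℂ) * e x = e x
      rw [χ.one_of_mem_closedBall (Metric.ball_subset_closedBall hx), Complex.ofReal_one, one_mul]
  have key := hweak (fun x => (χ x : ℂ) * e x)
    ((Complex.ofRealCLM.contDiff.comp χ.contDiff).mul he)
    ((χ.hasCompactSupport.comp_left (g := fun r : ℝ => (r : ℂ)) Complex.ofReal_zero).mul_right)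
  rw [integral_mul_eq_of_eqOn hg ((eqOn_partialDeriv hEq Metric.isOpen_ball β).mono hball),
    integral_mul_eq_of_eqOn hhc (hEq.mono hball), partialDeriv_character] at key
  have hchar (u : EuclideanSpace ℝ (Fin n) → ℂ) : 𝓕⁻ u w = ∫ x, u x * e x := by
    rw [Real.fourierInv_eq']
    refine integral_congr_ae (Eventually.of_forall fun x => ?_)
    simp only [e, one_mul, smul_eq_mul, mul_comm]
  have hsq : ((-1 : ℂ) ^ β.degree) * (-1) ^ β.degree = 1 := by
    rw [← mul_pow]
    simp
  have h1 : ∫ x, g x * (1 * (Complex.I ^ β.degree * monom β ((2 * Real.pi) • w)) *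
      Complex.exp ((2 * Real.pi * inner ℝ x w : ℝ) * Complex.I)) =
      Complex.I ^ β.degree * monom β ((2 * Real.pi) • w) * 𝓕⁻ g w := by
    rw [hchar, ← integral_const_mul]
    refine integral_congr_ae (Eventually.of_forall fun x => ?_)
    simp only [e]
    ring
  rw [h1] at key
  rw [hchar h, ← one_mul (∫ x, h x * e x), ← hsq, mul_assoc, ← key, neg_pow Complex.I]
  ring

/-- The weak derivative h is supported in the cube, hence integrable, and Plancherel puts `𝓕⁻ h` in
L². Up to a unimodular constant and a dilation this is `x^β f`. -/
theorem memLp_monom_mul_of_weakDeriv {c : ℝ} {f g : EuclideanSpace ℝ (Fin n) → ℂ}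
    (hfg : ∀ w, f ((2 * Real.pi) • w) = 𝓕⁻ g w) (hg : SuppInCube c g) {β : Fin n →₀ ℕ}
    (hβ : WeakDerivMemL2 β g) : MemLp (fun x => (monom β x : ℂ) * f x) 2 volume := by
  obtain ⟨h, hh, hweak⟩ := hβ
  have hh1 := (suppInCube_of_weakDeriv hg hh hweak).integrable hh
  have h1 : MemLp (𝓕⁻ h) 2 volume :=
    (memLp_congr_ae (fourierInv_toLp_ae_eq hh1 hh)).1 (Lp.memLp _)
  have h2 : (fun w => Complex.I ^ β.degree * 𝓕⁻ h w) =
      fun w => (monom β ((2 * Real.pi) • w) : ℂ) * f ((2 * Real.pi) • w) := by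
    ext w
    rw [fourierInv_weakDeriv hg hh hweak, ← mul_assoc, ← mul_pow, hfg]
    simp
  have h3 := h1.const_mul (Complex.I ^ β.degree)
  rw [h2] at h3
  have h4 := memLp_comp_smul (u := fun w =>
    (monom β ((2 * Real.pi) • w) : ℂ) * f ((2 * Real.pi) • w)) h3
    (inv_ne_zero Real.two_pi_pos.ne')
  simpa only [smul_inv_smul₀ Real.two_pi_pos.ne'] using h4

end MomentDensity

end

/-! ### The equivalences. -/

theorem mainTheorem11 (n : ℕ) (hn : 1 ≤ n) (d : ℕ) (s : (Fin n →₀ ℕ) → ℝ) :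
    List.TFAE [
      -- (i)
      MomentDensity.IsEntireSeries s ∧
        (∀ β : Fin n →₀ ℕ, β.degree ≤ d →
          MemLp (fun x => (MomentDensity.monom β x : ℂ) * MomentDensity.charSeries s x) 2 volume) ∧
        ∃ hf : MemLp (MomentDensity.charSeries s) 2 volume,
          MomentDensity.NonnegAE (MomentDensity.density (MomentDensity.charSeries s) hf) ∧
          ∃ c : ℝ, 0 ≤ c ∧
            MomentDensity.SuppInCube c (MomentDensity.density (MomentDensity.charSeries s) hf),
      -- (ii)
      MomentDensity.IsEntireSeries s ∧
        (∀ β : Fin n →₀ ℕ, β.degree ≤ d →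
          MemLp (fun x => (MomentDensity.monom β x : ℂ) * MomentDensity.charSeries s x) 2 volume) ∧
        (∃ hf : MemLp (MomentDensity.charSeries s) 2 volume,
          MomentDensity.NonnegAE (MomentDensity.density (MomentDensity.charSeries s) hf)) ∧
        ∃ c : ℝ, 0 ≤ c ∧ MomentDensity.MomentGrowth c s,
      -- (iii)
      (∀ β : Fin n →₀ ℕ, β.degree ≤ d →
          MomentDensity.IsEntireSeries (MomentDensity.momentDeriv β s)) ∧
        (∀ β : Fin n →₀ ℕ, β.degree ≤ d →
          MemLp (MomentDensity.charSeries (MomentDensity.momentDeriv β s)) 2 volume) ∧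
        ∃ hf : MemLp (MomentDensity.charSeries (MomentDensity.momentDeriv 0 s)) 2 volume,
          MomentDensity.NonnegAE (MomentDensity.density
            (MomentDensity.charSeries (MomentDensity.momentDeriv 0 s)) hf) ∧
          ∃ c : ℝ, 0 ≤ c ∧ MomentDensity.SuppInCube c (MomentDensity.density
            (MomentDensity.charSeries (MomentDensity.momentDeriv 0 s)) hf),
      -- (iv)
      (∀ β : Fin n →₀ ℕ, β.degree ≤ d →
          MomentDensity.IsEntireSeries (MomentDensity.momentDeriv β s)) ∧
        (∀ β : Fin n →₀ ℕ, β.degree ≤ d →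
          MemLp (MomentDensity.charSeries (MomentDensity.momentDeriv β s)) 2 volume) ∧
        (∃ hf : MemLp (MomentDensity.charSeries (MomentDensity.momentDeriv 0 s)) 2 volume,
          MomentDensity.NonnegAE (MomentDensity.density
            (MomentDensity.charSeries (MomentDensity.momentDeriv 0 s)) hf)) ∧
        ∃ c : ℝ, 0 ≤ c ∧ MomentDensity.MomentGrowth c s,
      -- (v)
      MomentDensity.IsDeterminate s ∧
        ∃ g : EuclideanSpace ℝ (Fin n) → ℂ,
          MemLp g 2 volume ∧
          MomentDensity.Represents (volume.withDensity fun x => ENNReal.ofReal (g x).re) s ∧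
          (∀ β : Fin n →₀ ℕ, β.degree ≤ d → MomentDensity.WeakDerivMemL2 β g) ∧
          MomentDensity.NonnegAE g ∧
          ∃ c : ℝ, 0 ≤ c ∧ MomentDensity.SuppInCube c g] := by
  -- Only entireness and square integrability differ between (i), (ii) and (iii), (iv); the
  -- remaining conditions ride along as `P`.
  have h13 : ∀ P : Prop, (∀ β : Fin n →₀ ℕ, β.degree ≤ d →
      MomentDensity.IsEntireSeries (MomentDensity.momentDeriv β s)) ∧
        (∀ β : Fin n →₀ ℕ, β.degree ≤ d →
          MemLp (MomentDensity.charSeries (MomentDensity.momentDeriv β s)) 2 volume) ∧ P ↔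
      MomentDensity.IsEntireSeries s ∧ (∀ β : Fin n →₀ ℕ, β.degree ≤ d →
          MemLp (fun x => (MomentDensity.monom β x : ℂ) * MomentDensity.charSeries s x) 2
            volume) ∧ P := by
    intro P
    constructor
    · rintro ⟨h1, h2, h3⟩
      have h0 := h1 0 (by simp)
      rw [MomentDensity.momentDeriv_zero] at h0
      exact ⟨h0, fun β hβ =>
        (MomentDensity.memLp_charSeries_momentDeriv_iff h0 β).1 (h2 β hβ), h3⟩
    · rintro ⟨h1, h2, h3⟩
      exact ⟨fun β _ => h1.momentDeriv β, fun β hβ =>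
        (MomentDensity.memLp_charSeries_momentDeriv_iff h1 β).2 (h2 β hβ), h3⟩
  have h0 := MomentDensity.momentDeriv_zero s
  -- The density depends on the proof `hf`, so `f_0 = f` is applied by generalizing and
  -- substituting.
  generalize MomentDensity.momentDeriv 0 s = s₀ at h0 ⊢
  obtain rfl : s = s₀ := h0.symm
  simp only [h13]
  tfae_have 1 ↔ 2 := by
    constructor
    · rintro ⟨h1, h2, hf, hnn, c, hc, hsupp⟩
      obtain ⟨hint, hrep⟩ := MomentDensity.represents_density h1 hf hnn
      exact ⟨h1, h2, ⟨hf, hnn⟩, c, hc, (hrep.momentGrowth_iff hc).2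
        ((MomentDensity.ae_withDensity_iff_suppInCube hint.1 hnn c).2 hsupp)⟩
    · rintro ⟨h1, h2, ⟨hf, hnn⟩, c, hc, hgrow⟩
      obtain ⟨hint, hrep⟩ := MomentDensity.represents_density h1 hf hnn
      exact ⟨h1, h2, hf, hnn, c, hc,
        (MomentDensity.ae_withDensity_iff_suppInCube hint.1 hnn c).1
          ((hrep.momentGrowth_iff hc).1 hgrow)⟩
  tfae_have 1 ↔ 3 := Iff.rfl
  tfae_have 2 ↔ 4 := Iff.rfl
  tfae_have 1 → 5 := by
    rintro ⟨h1, h2, hf, hnn, c, hc, hsupp⟩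
    obtain ⟨hint, hrep⟩ := MomentDensity.represents_density h1 hf hnn
    have hμ := (MomentDensity.ae_withDensity_iff_suppInCube hint.1 hnn c).2 hsupp
    have hd := MomentDensity.density_ae_eq hf
      (MomentDensity.memLp_comp_smul hf Real.two_pi_pos.ne')
    exact ⟨hrep.isDeterminate hc hμ, MomentDensity.density (MomentDensity.charSeries s) hf,
      (memLp_congr_ae hd).2 (Lp.memLp _), hrep,
      fun β hβ => MomentDensity.weakDerivMemL2_density hf (h2 β hβ), hnn, c, hc, hsupp⟩
  tfae_have 5 → 1 := by
    rintro ⟨-, g, hg2, hrep, hweak, hnn, c, hc, hsupp⟩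
    have hg1 := hsupp.integrable hg2
    have hμ := (MomentDensity.ae_withDensity_iff_suppInCube hg2.1 hnn c).2 hsupp
    have hfg (w : EuclideanSpace ℝ (Fin n)) :
        MomentDensity.charSeries s ((2 * Real.pi) • w) = 𝓕⁻ g w := by
      rw [← hrep.charFun_eq hc hμ, MomentDensity.charFun_withDensity hg2.1 hnn]
    have hmem (β : Fin n →₀ ℕ) (hβ : β.degree ≤ d) :=
      MomentDensity.memLp_monom_mul_of_weakDeriv hfg hsupp (hweak β hβ)
    have hf : MemLp (MomentDensity.charSeries s) 2 volume := by
      simpa [MomentDensity.monom] using hmem 0 (by simp)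
    have hf' := MomentDensity.memLp_comp_smul hf Real.two_pi_pos.ne'
    have hinv : hf'.toLp _ =
        (𝓕⁻ (hg2.toLp g) : Lp ℂ 2 (volume : Measure (EuclideanSpace ℝ (Fin n)))) := by
      refine Lp.ext (hf'.coeFn_toLp.trans ?_)
      rw [funext hfg]
      exact (MomentDensity.fourierInv_toLp_ae_eq hg1 hg2).symm
    -- By L² inversion the density computed from f is the given g, so its sign and support carry
    -- over.
    have hd : MomentDensity.density (MomentDensity.charSeries s) hf =ᵐ[volume] g := by
      have h := MomentDensity.density_ae_eq hf hf'
      rw [hinv, FourierInvPair.fourier_fourierInv_eq] at h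
      exact h.trans hg2.coeFn_toLp
    refine ⟨hrep.isEntireSeries hc hμ, hmem, hf, ?_, c, hc, ?_⟩
    · filter_upwards [hnn, hd] with x hx hx'
      rwa [hx']
    · filter_upwards [hsupp, hd] with x hx hx'
      rwa [hx']
  tfae_finish
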